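/- Let $G$ be a finite group and $S$ a finite set of primes. A polynomial $P$ in one variable with coefficients in $\mathbb{Q}(t_1,\dots,t_m)$ is called *generic for $G$ outside $S$* if: 1. the Galois group of the splitting field of $P$ over $\mathbb{Q}(t_1,\dots,t_m)$ is isomorphic to $G$; 2. for every prime $p\notin S$ the reduction of $P$ modulo $p$ is defined, separable and irreducible over $\mathbb{F}_p(t_1,\dots,t_m)$, and the Galois group of its splitting field over $\mathbb{F}_p(t_1,\dots,t_m)$ is isomorphic to $G$; 3. if $K$ is a field of characteristic $0$ and $L/K$ is a Galois extension with group $G$, then $L$ is the splitting field over $K$ of a polynomial obtained by specializing $(t_1,\dots,t_m)$ in $P$ to some values $(\tau_1,\dots,\tau_m)$ in $K$; 4. if $K$ is a field of characteristic $p>0$ with $p\notin S$ and $L/K$ is a Galois extension with group $G$, then $L$ is the splitting field over $K$ of a polynomial obtained by reducing $P$ modulo $p$ and then specializing $(t_1,\dots,t_m)$ to some values $(\tau_1,\dots,\tau_m)$ in $K$. Let $P_1(A,\Delta,M)$ be the polynomial in $z$ $$\begin{aligned} &288M^2z^5\\ &+(279890625\Delta^2A^2+262154475\Delta A^4-3666000MA\Delta-2041200MA^3+59541075A^6+87890625\Delta^3+14880M^2)z^4\\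 &+(3711849300\Delta A^4+6170437500\Delta^2A^2-83428000MA\Delta-23781600MA^3+538658100A^6-351562500\Delta^3+259520M^2)z^3\\ &+(15376579650\Delta A^4+22131843750\Delta^2A^2-372984000MA\Delta-130420800MA^3+2685964050A^6+527343750\Delta^3+1583040M^2)z^2\\ &+(9952607700\Delta A^4+15161437500\Delta^2A^2-243612000MA\Delta-79322400MA^3+1619910900A^6-351562500\Delta^3+971040M^2)z\\ &-42806000MA\Delta+1743266475\Delta A^4+2912390625\Delta^2A^2+157216M^2-12805200MA^3+260745075A^6+87890625\Delta^3, \end{aligned}$$ and let $P_2(\delta,q)$ be the polynomial in $u$ $$\begin{aligned} &u^2(u+50)^3\\ &-20(611\delta u^3+8505u^3+39270\delta u^2+263250u^2+4050000u+438000\delta u+100000\delta)\,u\,q\\ &+2(25+3\delta)(625\delta^2u^4+44550\delta u^4+793881u^4+18370800u^3+3175200\delta u^3-10000\delta^2u^3\\ &\qquad+262440000u^2+60000\delta^2u^2+25336800\delta u^2-160000\delta^2u+12960000\delta u+160000\delta^2)\,q^2. \end{aligned}$$ **Theorem.** The polynomial $P_1(A,D^2,M)$ over $\mathbb{Q}(A,D,M)$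 and the polynomial $P_2(d^2,q)$ over $\mathbb{Q}(d,q)$, with $A,D,M$ and $d,q$ indeterminates, are generic for the alternating group $A_5$ outside $\{2,3,5\}$. -/

import Mathlib

open Polynomial

/-- The field `F(t_1, …, t_m)` of rational functions in `m` indeterminates over `F`. -/
abbrev RatFunField (F : Type) [Field F] (m : ℕ) : Type :=
  FractionRing (MvPolynomial (Fin m) F)

/-- The `i`-th indeterminate, as an element of `F(t_1, …, t_m)`. -/
noncomputable def indet (F : Type) [Field F] {m : ℕ} (i : Fin m) : RatFunField F m :=
  algebraMap (MvPolynomial (Fin m) F) (RatFunField F m) (MvPolynomial.X i)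

/-- Specialization `t ↦ τ`: every coefficient of `P` is a quotient `a / b` of polynomials over `F`
with `b(τ) ≠ 0`, and the corresponding coefficient of `Q` is `a(τ) / b(τ)`. -/
def SpecializesTo {F : Type} [Field F] {m : ℕ} (P : (RatFunField F m)[X])
    {K : Type*} [Field K] [Algebra F K] (τ : Fin m → K) (Q : K[X]) : Prop :=
  ∀ n : ℕ, ∃ a b : MvPolynomial (Fin m) F,
    MvPolynomial.aeval τ b ≠ 0 ∧
    P.coeff n * algebraMap _ (RatFunField F m) b = algebraMap _ (RatFunField F m) a ∧
    Q.coeff n * MvPolynomial.aeval τ b = MvPolynomial.aeval τ a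

/-- Reduction modulo `p`: every coefficient of `P` is a quotient `a / b` of polynomials over `ℤ`
with `b` not divisible by `p`, and the corresponding coefficient of `Q` is the
quotient of the reductions of `a` and `b` modulo `p`. -/
def ReducesTo (p : ℕ) [Fact p.Prime] {m : ℕ} (P : (RatFunField ℚ m)[X])
    (Q : (RatFunField (ZMod p) m)[X]) : Prop :=
  ∀ n : ℕ, ∃ a b : MvPolynomial (Fin m) ℤ,
    b.map (Int.castRingHom (ZMod p)) ≠ 0 ∧
    P.coeff n * algebraMap _ (RatFunField ℚ m) (b.map (Int.castRingHom ℚ)) =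
      algebraMap _ (RatFunField ℚ m) (a.map (Int.castRingHom ℚ)) ∧
    Q.coeff n * algebraMap _ (RatFunField (ZMod p) m) (b.map (Int.castRingHom (ZMod p))) =
      algebraMap _ (RatFunField (ZMod p) m) (a.map (Int.castRingHom (ZMod p)))

universe u v

/-- Every Galois extension `L / K` with group `G`, where `K` is a field containing `F`, is the
splitting field of a specialization of `P` to values in `K`. For `F = ℚ` the fields `K` are those
of characteristic `0`, and for `F = ZMod p` those of characteristic `p`. -/
def ParametrizesExtensions {F : Type} [Field F] {m : ℕ} (P : (RatFunField F m)[X])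
    (G : Type) [Group G] : Prop :=
  ∀ (K : Type u) [Field K] [Algebra F K] (L : Type v) [Field L] [Algebra K L]
    [FiniteDimensional K L] [IsGalois K L],
    Nonempty ((L ≃ₐ[K] L) ≃* G) →
      ∃ (τ : Fin m → K) (Q : K[X]), SpecializesTo P τ Q ∧ Q.IsSplittingField K L

/-- `P`, with coefficients in `ℚ(t_1, …, t_m)`, is a generic polynomial for the group `G` outside
the finite set `S` of primes. -/
structure IsGenericOutside (S : Finset ℕ) (G : Type) [Group G] {m : ℕ}
    (P : (RatFunField ℚ m)[X]) : Prop where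
  /-- The Galois group over `ℚ(t_1, …, t_m)` is `G`. -/
  gal : Nonempty (P.Gal ≃* G)
  /-- All `G`-extensions in characteristic `0` are obtained by specialization. -/
  parametrizes : ParametrizesExtensions.{u, v} P G
  /-- For `p ∉ S` the reduction modulo `p` is defined, separable and irreducible, it has Galois
  group `G` over `𝔽_p(t_1, …, t_m)`, and all `G`-extensions in characteristic `p` are obtained
  from it by specialization. -/
  reduction : ∀ (p : ℕ) [Fact p.Prime], p ∉ S →
    ∃ Pbar : (RatFunField (ZMod p) m)[X],
      ReducesTo p P Pbar ∧ Pbar.Separable ∧ Irreducible Pbar ∧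
      Nonempty (Pbar.Gal ≃* G) ∧ ParametrizesExtensions.{u, v} Pbar G

/-- The first quintic polynomial, in three parameters `A`, `Δ`, `M`. -/
noncomputable def firstPolynomial {R : Type*} [CommRing R] (A Δ M : R) : R[X] :=
  C (288 * M ^ 2) * X ^ 5
  + C (279890625 * Δ ^ 2 * A ^ 2 + 262154475 * Δ * A ^ 4 - 3666000 * M * A * Δ
      - 2041200 * M * A ^ 3 + 59541075 * A ^ 6 + 87890625 * Δ ^ 3 + 14880 * M ^ 2) * X ^ 4
  + C (3711849300 * Δ * A ^ 4 + 6170437500 * Δ ^ 2 * A ^ 2 - 83428000 * M * A * Δ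
      - 23781600 * M * A ^ 3 + 538658100 * A ^ 6 - 351562500 * Δ ^ 3 + 259520 * M ^ 2) * X ^ 3
  + C (15376579650 * Δ * A ^ 4 + 22131843750 * Δ ^ 2 * A ^ 2 - 372984000 * M * A * Δ
      - 130420800 * M * A ^ 3 + 2685964050 * A ^ 6 + 527343750 * Δ ^ 3
      + 1583040 * M ^ 2) * X ^ 2
  + C (9952607700 * Δ * A ^ 4 + 15161437500 * Δ ^ 2 * A ^ 2 - 243612000 * M * A * Δ
      - 79322400 * M * A ^ 3 + 1619910900 * A ^ 6 - 351562500 * Δ ^ 3 + 971040 * M ^ 2) * X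
  + C (-42806000 * M * A * Δ + 1743266475 * Δ * A ^ 4 + 2912390625 * Δ ^ 2 * A ^ 2
      + 157216 * M ^ 2 - 12805200 * M * A ^ 3 + 260745075 * A ^ 6 + 87890625 * Δ ^ 3)

/-- The second quintic polynomial, in two parameters `δ`, `q`. -/
noncomputable def secondPolynomial {R : Type*} [CommRing R] (δ q : R) : R[X] :=
  X ^ 2 * (X + 50) ^ 3
  - 20 * (611 * C δ * X ^ 3 + 8505 * X ^ 3 + 39270 * C δ * X ^ 2 + 263250 * X ^ 2 + 4050000 * X
      + 438000 * C δ * X + 100000 * C δ) * X * C q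
  + 2 * (25 + 3 * C δ) * (625 * C δ ^ 2 * X ^ 4 + 44550 * C δ * X ^ 4 + 793881 * X ^ 4
      + 18370800 * X ^ 3 + 3175200 * C δ * X ^ 3 - 10000 * C δ ^ 2 * X ^ 3
      + 262440000 * X ^ 2 + 60000 * C δ ^ 2 * X ^ 2 + 25336800 * C δ * X ^ 2
      - 160000 * C δ ^ 2 * X + 12960000 * C δ * X + 160000 * C δ ^ 2) * C q ^ 2

/-!
The quintics come from the invariant theory of five points on the projective line. To points
`x 0, …, x 4` belong three invariants of the binary quintic form with these roots: a form `A` of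
degree `4` (`pentagonSum`), the square root `D` of the discriminant (`sqrtDisc`), which changes sign
under odd permutations, and a form `M` of degree `12` (`hessProd`). A projective invariant `u i` of
the five points, in which the `i`-th is distinguished (`coordU`), satisfies
`P₂ ((10 D / A) ^ 2, A ^ 3 / (64 M)) (u i) = 0` and `P₁ (A, (2 D) ^ 2, 8 M) ((u i - 1) / 3) = 0`
(`eval_secondPolynomial`, `eval_firstPolynomial`). For the proof one of the points is moved to `∞`
and the others are taken to be the roots of `Y ^ 4 + p Y ^ 2 + q Y + r` (`IsChart`). Then everything
depends, up to scaling, on `v = q ^ 2 / p ^ 3` and `ρ = r / p ^ 2` only (`HasShape`), and `u 0` is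
an affine function of `ρ`.

*Parametrization.* A Galois extension `L / K` with group `A₅` contains five elements that `A₅`
permutes like the five indices, and these can be chosen outside of any given proper Zariski closed
set, as `K` is infinite (`exists_isEquivariant_eval_ne_zero`). Their invariants `A`, `D` and `M` lie
in `K`, so that the `u i` are five distinct roots of a specialization of `P₂`, and `A₅` acts
faithfully on them; hence they generate `L`.

*Galois group over the field of rational functions.* Let `E = F(x 0, …, x 4)`. The invariants `A`,
`D` and `M` are algebraically independent (`algebraicIndependent_invariants`), so the field of
rational functions in the indeterminates of `P₁` or `P₂` embeds into `E` by sending these to the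
parameters above, and its image `k` is fixed by `A₅`. Since `A₅` permutes the `u i` in `E`
transitively, the quintic is irreducible and separable, and its group contains `A₅`. Equality
follows from a bound for the degree of the field that the `u i` generate: it is at most `60`
(`finrank_adjoin_coordU_le`). The element `u 0` has degree `5`. The elements `v` and `ρ` lie in
`k (u 0)`, because `D ^ 2 / A ^ 2` and `A ^ 3 / M` give two equations for `v` over `k (ρ)`
that have only one common solution (`mem_adjoin_of_shape`). After a scaling, the four points other
than `x 0` are the roots of a quartic over `k (u 0)`. Its discriminant is a square, because `D / A`
lies in `k`, so that its splitting field, which contains all the `u i`, has degree at most `12` over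
`k (u 0)`.

All of this works over a field of any characteristic other than `2`, `3` and `5`.
-/

/-! ### Invariants of five points -/

section Invariants

variable {R : Type*} [CommRing R]

/-- The squared difference of two points. -/
def sqDist (a b : R) : R := (a - b) ^ 2

lemma sqDist_comm (a b : R) : sqDist a b = sqDist b a := by
  simp only [sqDist]; ring

/-- The invariant of degree `4` of the binary quintic form with roots `x 0, …, x 4`, up to a
constant: the sum over the twelve pentagons with vertices `x i` of the product of the squared
edges. -/
def pentagonSum (x : Fin 5 → R) : R :=
  sqDist (x 0) (x 1) * sqDist (x 0) (x 2) * sqDist (x 1) (x 3) *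
    sqDist (x 2) (x 4) * sqDist (x 3) (x 4) +
  sqDist (x 0) (x 1) * sqDist (x 0) (x 2) * sqDist (x 1) (x 4) *
    sqDist (x 2) (x 3) * sqDist (x 3) (x 4) +
  sqDist (x 0) (x 1) * sqDist (x 0) (x 3) * sqDist (x 1) (x 2) *
    sqDist (x 2) (x 4) * sqDist (x 3) (x 4) +
  sqDist (x 0) (x 1) * sqDist (x 0) (x 3) * sqDist (x 1) (x 4) *
    sqDist (x 2) (x 3) * sqDist (x 2) (x 4) +
  sqDist (x 0) (x 1) * sqDist (x 0) (x 4) * sqDist (x 1) (x 2) *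
    sqDist (x 2) (x 3) * sqDist (x 3) (x 4) +
  sqDist (x 0) (x 1) * sqDist (x 0) (x 4) * sqDist (x 1) (x 3) *
    sqDist (x 2) (x 3) * sqDist (x 2) (x 4) +
  sqDist (x 0) (x 2) * sqDist (x 0) (x 3) * sqDist (x 1) (x 2) *
    sqDist (x 1) (x 4) * sqDist (x 3) (x 4) +
  sqDist (x 0) (x 2) * sqDist (x 0) (x 3) * sqDist (x 1) (x 3) *
    sqDist (x 1) (x 4) * sqDist (x 2) (x 4) +
  sqDist (x 0) (x 2) * sqDist (x 0) (x 4) * sqDist (x 1) (x 2) *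
    sqDist (x 1) (x 3) * sqDist (x 3) (x 4) +
  sqDist (x 0) (x 2) * sqDist (x 0) (x 4) * sqDist (x 1) (x 3) *
    sqDist (x 1) (x 4) * sqDist (x 2) (x 3) +
  sqDist (x 0) (x 3) * sqDist (x 0) (x 4) * sqDist (x 1) (x 2) *
    sqDist (x 1) (x 3) * sqDist (x 2) (x 4) +
  sqDist (x 0) (x 3) * sqDist (x 0) (x 4) * sqDist (x 1) (x 2) *
    sqDist (x 1) (x 4) * sqDist (x 2) (x 3)

/-- The square root `∏_{i < j} (x j - x i)` of the discriminant. -/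
def sqrtDisc (x : Fin 5 → R) : R := ∏ i, ∏ j ∈ Finset.Ioi i, (x j - x i)

/-- The Hessian of the quartic form with roots `b, c, d, e`, evaluated at `a`, up to a constant. -/
def hessForm (a b c d e : R) : R :=
  sqDist b c * sqDist a d * sqDist a e + sqDist b d * sqDist a c * sqDist a e +
  sqDist b e * sqDist a c * sqDist a d + sqDist c d * sqDist a b * sqDist a e +
  sqDist c e * sqDist a b * sqDist a d + sqDist d e * sqDist a b * sqDist a c

/-- Twice the quadratic invariant of the quartic with roots `b, c, d, e`. -/
def quarticForm (b c d e : R) : R :=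
  sqDist b c * sqDist d e + sqDist b d * sqDist c e + sqDist b e * sqDist c d

/-- `hessForm` at the point `x i`; the other points are listed in cyclic order. -/
def hess (x : Fin 5 → R) (i : Fin 5) : R :=
  hessForm (x i) (x (i + 1)) (x (i + 2)) (x (i + 3)) (x (i + 4))

/-- `quarticForm` of the four points other than `x i`. -/
def quart (x : Fin 5 → R) (i : Fin 5) : R :=
  quarticForm (x (i + 1)) (x (i + 2)) (x (i + 3)) (x (i + 4))

/-- The product `∏_{j ≠ i} (x i - x j)`. -/
def rootDeriv (x : Fin 5 → R) (i : Fin 5) : R :=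
  (x i - x (i + 1)) * (x i - x (i + 2)) * (x i - x (i + 3)) * (x i - x (i + 4))

/-- An invariant of degree `12` of the binary quintic form with roots `x 0, …, x 4`: the product,
over the roots, of the Hessian of the complementary quartic at the root. -/
def hessProd (x : Fin 5 → R) : R := ∏ i, hess x i

section Map

variable {S F : Type*} [CommRing S] [FunLike F R S] [RingHomClass F R S] (f : F) (x : Fin 5 → R)

lemma map_pentagonSum : f (pentagonSum x) = pentagonSum (fun i ↦ f (x i)) := by
  simp only [pentagonSum, sqDist, map_add, map_pow, map_mul, map_sub]

lemma map_sqrtDisc : f (sqrtDisc x) = sqrtDisc (fun i ↦ f (x i)) := by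
  simp only [sqrtDisc, map_prod, map_sub]

lemma map_hess (i : Fin 5) : f (hess x i) = hess (fun i ↦ f (x i)) i := by
  simp only [hess, hessForm, sqDist, map_add, map_pow, map_mul, map_sub]

lemma map_quart (i : Fin 5) : f (quart x i) = quart (fun i ↦ f (x i)) i := by
  simp only [quart, quarticForm, sqDist, map_add, map_pow, map_mul, map_sub]

lemma map_rootDeriv (i : Fin 5) : f (rootDeriv x i) = rootDeriv (fun i ↦ f (x i)) i := by
  simp only [rootDeriv, map_mul, map_sub]

lemma map_hessProd : f (hessProd x) = hessProd (fun i ↦ f (x i)) := by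
  simp only [hessProd, map_prod, map_hess]

end Map

section Symmetry

/-- Induction on the adjacent transpositions, which generate the symmetric group. -/
lemma perm_induction {motive : Equiv.Perm (Fin 5) → Prop} (one : motive 1)
    (mul : ∀ σ τ, motive σ → motive τ → motive (σ * τ))
    (h0 : motive (Equiv.swap 0 1)) (h1 : motive (Equiv.swap 1 2)) (h2 : motive (Equiv.swap 2 3))
    (h3 : motive (Equiv.swap 3 4)) (σ : Equiv.Perm (Fin 5)) : motive σ := by
  have hσ : σ ∈ Submonoid.closure
      (Set.range fun i : Fin 4 ↦ Equiv.swap i.castSucc i.succ) := by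
    rw [Equiv.Perm.mclosure_swap_castSucc_succ]; trivial
  induction hσ using Submonoid.closure_induction with
  | mem σ h =>
    obtain ⟨i, rfl⟩ := h
    fin_cases i
    exacts [h0, h1, h2, h3]
  | one => exact one
  | mul σ τ _ _ hσ hτ => exact mul σ τ hσ hτ

/-- The rewriting rules that sort the arguments of `sqDist`. -/
lemma sqDist_sort (x : Fin 5 → R) :
    (sqDist (x 1) (x 0) = sqDist (x 0) (x 1) ∧ sqDist (x 2) (x 0) = sqDist (x 0) (x 2) ∧
    sqDist (x 3) (x 0) = sqDist (x 0) (x 3) ∧ sqDist (x 4) (x 0) = sqDist (x 0) (x 4)) ∧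
    (sqDist (x 2) (x 1) = sqDist (x 1) (x 2) ∧ sqDist (x 3) (x 1) = sqDist (x 1) (x 3) ∧
    sqDist (x 4) (x 1) = sqDist (x 1) (x 4)) ∧ sqDist (x 3) (x 2) = sqDist (x 2) (x 3) ∧
    sqDist (x 4) (x 2) = sqDist (x 2) (x 4) ∧ sqDist (x 4) (x 3) = sqDist (x 3) (x 4) :=
  ⟨⟨sqDist_comm _ _, sqDist_comm _ _, sqDist_comm _ _, sqDist_comm _ _⟩,
    ⟨sqDist_comm _ _, sqDist_comm _ _, sqDist_comm _ _⟩, sqDist_comm _ _, sqDist_comm _ _,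
    sqDist_comm _ _⟩

lemma pentagonSum_comp (σ : Equiv.Perm (Fin 5)) :
    ∀ x : Fin 5 → R, pentagonSum (fun i ↦ x (σ i)) = pentagonSum x := by
  induction σ using perm_induction with
  | one => intro x; rfl
  | mul σ τ hσ hτ => intro x; exact (hτ fun i ↦ x (σ i)).trans (hσ x)
  | h0 | h1 | h2 | h3 =>
    intro x
    simp +decide only [pentagonSum, Equiv.swap_apply_def, if_true, if_false, sqDist_sort x]
    ring

lemma sqrtDisc_comp (x : Fin 5 → R) (σ : Equiv.Perm (Fin 5)) :
    sqrtDisc (fun i ↦ x (σ i)) = (Equiv.Perm.sign σ : ℤ) * sqrtDisc x := by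
  simp only [sqrtDisc, ← Matrix.det_vandermonde]
  exact_mod_cast Matrix.det_permute σ (Matrix.vandermonde x)

lemma forall_fin_five {p : Fin 5 → Prop} :
    (∀ i, p i) ↔ p 0 ∧ p 1 ∧ p 2 ∧ p 3 ∧ p 4 := by
  simp [Fin.forall_fin_succ]

lemma fin_five_add : ((0 : Fin 5) + 1 = 1 ∧ (0 : Fin 5) + 2 = 2 ∧ (0 : Fin 5) + 3 = 3 ∧
    (0 : Fin 5) + 4 = 4) ∧ ((1 : Fin 5) + 1 = 2 ∧ (1 : Fin 5) + 2 = 3 ∧ (1 : Fin 5) + 3 = 4 ∧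
    (1 : Fin 5) + 4 = 0) ∧ ((2 : Fin 5) + 1 = 3 ∧ (2 : Fin 5) + 2 = 4 ∧ (2 : Fin 5) + 3 = 0 ∧
    (2 : Fin 5) + 4 = 1) ∧ ((3 : Fin 5) + 1 = 4 ∧ (3 : Fin 5) + 2 = 0 ∧ (3 : Fin 5) + 3 = 1 ∧
    (3 : Fin 5) + 4 = 2) ∧ ((4 : Fin 5) + 1 = 0 ∧ (4 : Fin 5) + 2 = 1 ∧ (4 : Fin 5) + 3 = 2 ∧
    (4 : Fin 5) + 4 = 3) := by decide

lemma hess_comp (σ : Equiv.Perm (Fin 5)) :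
    ∀ (x : Fin 5 → R) (i : Fin 5), hess (fun i ↦ x (σ i)) i = hess x (σ i) := by
  induction σ using perm_induction with
  | one => intro x i; rfl
  | mul σ τ hσ hτ => intro x i; exact (hτ (fun i ↦ x (σ i)) i).trans (hσ x (τ i))
  | h0 | h1 | h2 | h3 =>
    intro x
    rw [forall_fin_five]
    simp +decide only [hess, hessForm, Equiv.swap_apply_def, fin_five_add, if_true, if_false,
      sqDist_sort x]
    refine ⟨?_, ?_, ?_, ?_, ?_⟩ <;> ring

lemma quart_comp (σ : Equiv.Perm (Fin 5)) :
    ∀ (x : Fin 5 → R) (i : Fin 5), quart (fun i ↦ x (σ i)) i = quart x (σ i) := by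
  induction σ using perm_induction with
  | one => intro x i; rfl
  | mul σ τ hσ hτ => intro x i; exact (hτ (fun i ↦ x (σ i)) i).trans (hσ x (τ i))
  | h0 | h1 | h2 | h3 =>
    intro x
    rw [forall_fin_five]
    simp +decide only [quart, quarticForm, Equiv.swap_apply_def, fin_five_add, if_true, if_false,
      sqDist_sort x]
    refine ⟨?_, ?_, ?_, ?_, ?_⟩ <;> ring

lemma rootDeriv_comp (σ : Equiv.Perm (Fin 5)) :
    ∀ (x : Fin 5 → R) (i : Fin 5), rootDeriv (fun i ↦ x (σ i)) i = rootDeriv x (σ i) := by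
  induction σ using perm_induction with
  | one => intro x i; rfl
  | mul σ τ hσ hτ => intro x i; exact (hτ (fun i ↦ x (σ i)) i).trans (hσ x (τ i))
  | h0 | h1 | h2 | h3 =>
    intro x
    rw [forall_fin_five]
    simp +decide only [rootDeriv, Equiv.swap_apply_def, fin_five_add, if_true, if_false]
    refine ⟨?_, ?_, ?_, ?_, ?_⟩ <;> ring

lemma hessProd_comp (σ : Equiv.Perm (Fin 5)) (x : Fin 5 → R) :
    hessProd (fun i ↦ x (σ i)) = hessProd x := by
  simp only [hessProd, hess_comp]
  exact Equiv.prod_comp σ _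

end Symmetry

end Invariants

section Coordinate

variable {K : Type*} [Field K]

/-- The projective invariant of five points, one of them distinguished, that yields the roots of the
quintics: it does not change under a projective transformation of the points, and a permutation of
the points permutes its five values. -/
def coordU (x : Fin 5 → K) (i : Fin 5) : K :=
  -25 * quart x i * rootDeriv x i ^ 2 / hess x i ^ 2

lemma coordU_comp (x : Fin 5 → K) (σ : Equiv.Perm (Fin 5)) (i : Fin 5) :
    coordU (fun i ↦ x (σ i)) i = coordU x (σ i) := by
  simp only [coordU, hess_comp, quart_comp, rootDeriv_comp]

lemma map_coordU {L F : Type*} [Field L] [FunLike F K L] [RingHomClass F K L] (f : F)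
    (x : Fin 5 → K) (i : Fin 5) : f (coordU x i) = coordU (fun i ↦ f (x i)) i := by
  have h25 : f (25 : K) = 25 := map_ofNat f 25
  simp only [coordU, map_div₀, map_mul, map_neg, map_pow, map_hess, map_quart, map_rootDeriv, h25]

end Coordinate

/-! ### Five points with one of them at infinity -/

section Chart

variable {R : Type*} [CommRing R]

/-- `pentagonSum` for the points `∞, y 0, …, y 3`. -/
def pathSum (y : Fin 4 → R) : R :=
  sqDist (y 0) (y 1) * sqDist (y 1) (y 2) * sqDist (y 2) (y 3) +
  sqDist (y 0) (y 1) * sqDist (y 1) (y 3) * sqDist (y 2) (y 3) +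
  sqDist (y 0) (y 2) * sqDist (y 1) (y 2) * sqDist (y 1) (y 3) +
  sqDist (y 0) (y 2) * sqDist (y 2) (y 3) * sqDist (y 1) (y 3) +
  sqDist (y 0) (y 3) * sqDist (y 1) (y 3) * sqDist (y 1) (y 2) +
  sqDist (y 0) (y 3) * sqDist (y 2) (y 3) * sqDist (y 1) (y 2) +
  sqDist (y 0) (y 1) * sqDist (y 0) (y 2) * sqDist (y 2) (y 3) +
  sqDist (y 0) (y 1) * sqDist (y 0) (y 3) * sqDist (y 2) (y 3) +
  sqDist (y 0) (y 2) * sqDist (y 0) (y 1) * sqDist (y 1) (y 3) +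
  sqDist (y 0) (y 2) * sqDist (y 0) (y 3) * sqDist (y 1) (y 3) +
  sqDist (y 0) (y 3) * sqDist (y 0) (y 1) * sqDist (y 1) (y 2) +
  sqDist (y 0) (y 3) * sqDist (y 0) (y 2) * sqDist (y 1) (y 2)

/-- `hessForm` at the point `a`, for the points `∞, a, b, c, d`. -/
def hessAffine (a b c d : R) : R :=
  sqDist b c * sqDist a d + sqDist b d * sqDist a c + sqDist c d * sqDist a b +
  sqDist a c * sqDist a d + sqDist a b * sqDist a d + sqDist a b * sqDist a c

/-- The sum of the squared differences of four points: the value of `hessForm` at `∞`. -/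
def sqDistSum (y : Fin 4 → R) : R :=
  sqDist (y 0) (y 1) + sqDist (y 0) (y 2) + sqDist (y 0) (y 3) + sqDist (y 1) (y 2) +
  sqDist (y 1) (y 3) + sqDist (y 2) (y 3)

/-- The square root `∏_{i < j} (y j - y i)` of the discriminant of four points. -/
def sqrtDiscFour (y : Fin 4 → R) : R := ∏ i, ∏ j ∈ Finset.Ioi i, (y j - y i)

lemma sqrtDiscFour_eq (y : Fin 4 → R) :
    sqrtDiscFour y = (y 1 - y 0) * (y 2 - y 0) * (y 3 - y 0) * (y 2 - y 1) * (y 3 - y 1) *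
      (y 3 - y 2) := by
  have h0 : Finset.Ioi (0 : Fin 4) = {1, 2, 3} := by decide
  have h1 : Finset.Ioi (1 : Fin 4) = {2, 3} := by decide
  have h2 : Finset.Ioi (2 : Fin 4) = {3} := by decide
  have h3 : Finset.Ioi (3 : Fin 4) = ∅ := by decide
  simp [sqrtDiscFour, Fin.prod_univ_four, h0, h1, h2, h3]
  ring

lemma sqrtDisc_eq (x : Fin 5 → R) :
    sqrtDisc x = (x 1 - x 0) * (x 2 - x 0) * (x 3 - x 0) * (x 4 - x 0) * (x 2 - x 1) *
      (x 3 - x 1) * (x 4 - x 1) * (x 3 - x 2) * (x 4 - x 2) * (x 4 - x 3) := by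
  have h0 : Finset.Ioi (0 : Fin 5) = {1, 2, 3, 4} := by decide
  have h1 : Finset.Ioi (1 : Fin 5) = {2, 3, 4} := by decide
  have h2 : Finset.Ioi (2 : Fin 5) = {3, 4} := by decide
  have h3 : Finset.Ioi (3 : Fin 5) = {4} := by decide
  have h4 : Finset.Ioi (4 : Fin 5) = ∅ := by decide
  simp [sqrtDisc, Fin.prod_univ_five, h0, h1, h2, h3, h4]
  ring

/-- The points `x 1, …, x 4` have, relative to `x 0`, the coordinates `t i`, and
`y 0, …, y 3` are, up to a common translation, the inverses of the `t i`. -/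
structure IsChart (x : Fin 5 → R) (t y : Fin 4 → R) : Prop where
  sub_zero : ∀ i, x i.succ - x 0 = t i
  sub_succ : ∀ i j, x i.succ - x j.succ = t i * t j * (y j - y i)

namespace IsChart

variable {x : Fin 5 → R} {t y : Fin 4 → R} (h : IsChart x t y)
include h

lemma sub_eq :
    (x 1 - x 0 = t 0 ∧ x 2 - x 0 = t 1 ∧ x 3 - x 0 = t 2 ∧ x 4 - x 0 = t 3) ∧
    (x 0 - x 1 = -t 0 ∧ x 0 - x 2 = -t 1 ∧ x 0 - x 3 = -t 2 ∧ x 0 - x 4 = -t 3) ∧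
    (x 1 - x 2 = t 0 * t 1 * (y 1 - y 0) ∧ x 1 - x 3 = t 0 * t 2 * (y 2 - y 0) ∧
      x 1 - x 4 = t 0 * t 3 * (y 3 - y 0)) ∧
    (x 2 - x 1 = t 1 * t 0 * (y 0 - y 1) ∧ x 2 - x 3 = t 1 * t 2 * (y 2 - y 1) ∧
      x 2 - x 4 = t 1 * t 3 * (y 3 - y 1)) ∧
    (x 3 - x 1 = t 2 * t 0 * (y 0 - y 2) ∧ x 3 - x 2 = t 2 * t 1 * (y 1 - y 2) ∧
      x 3 - x 4 = t 2 * t 3 * (y 3 - y 2)) ∧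
    (x 4 - x 1 = t 3 * t 0 * (y 0 - y 3) ∧ x 4 - x 2 = t 3 * t 1 * (y 1 - y 3) ∧
      x 4 - x 3 = t 3 * t 2 * (y 2 - y 3)) := by
  have h0 := h.sub_zero
  have hs := h.sub_succ
  refine ⟨⟨h0 0, h0 1, h0 2, h0 3⟩, ⟨?_, ?_, ?_, ?_⟩, ⟨hs 0 1, hs 0 2, hs 0 3⟩,
    ⟨hs 1 0, hs 1 2, hs 1 3⟩, ⟨hs 2 0, hs 2 1, hs 2 3⟩, ⟨hs 3 0, hs 3 1, hs 3 2⟩⟩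
  · rw [← h0 0, neg_sub]; rfl
  · rw [← h0 1, neg_sub]; rfl
  · rw [← h0 2, neg_sub]; rfl
  · rw [← h0 3, neg_sub]; rfl

/-- The squared differences, in the chart. -/
lemma sqDist_eq :
    (sqDist (x 0) (x 1) = t 0 ^ 2 ∧ sqDist (x 0) (x 2) = t 1 ^ 2 ∧
      sqDist (x 0) (x 3) = t 2 ^ 2 ∧ sqDist (x 0) (x 4) = t 3 ^ 2) ∧
    (sqDist (x 1) (x 2) = t 0 ^ 2 * t 1 ^ 2 * sqDist (y 0) (y 1) ∧
      sqDist (x 1) (x 3) = t 0 ^ 2 * t 2 ^ 2 * sqDist (y 0) (y 2) ∧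
      sqDist (x 1) (x 4) = t 0 ^ 2 * t 3 ^ 2 * sqDist (y 0) (y 3)) ∧
    sqDist (x 2) (x 3) = t 1 ^ 2 * t 2 ^ 2 * sqDist (y 1) (y 2) ∧
    sqDist (x 2) (x 4) = t 1 ^ 2 * t 3 ^ 2 * sqDist (y 1) (y 3) ∧
    sqDist (x 3) (x 4) = t 2 ^ 2 * t 3 ^ 2 * sqDist (y 2) (y 3) := by
  simp only [sqDist, h.sub_eq]
  refine ⟨⟨?_, ?_, ?_, ?_⟩, ⟨?_, ?_, ?_⟩, ?_, ?_, ?_⟩ <;> ring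

lemma pentagonSum_eq : pentagonSum x = (t 0 * t 1 * t 2 * t 3) ^ 4 * pathSum y := by
  simp only [pentagonSum, h.sqDist_eq, pathSum]
  ring

lemma sqrtDisc_eq : sqrtDisc x = (t 0 * t 1 * t 2 * t 3) ^ 4 * sqrtDiscFour y := by
  simp only [_root_.sqrtDisc_eq, sqrtDiscFour_eq, h.sub_eq]
  ring

lemma hess_zero : hess x 0 = (t 0 * t 1 * t 2 * t 3) ^ 2 * sqDistSum y := by
  simp only [hess, hessForm, fin_five_add, h.sqDist_eq, sqDistSum]
  ring

lemma quart_zero :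
    quart x 0 = (t 0 * t 1 * t 2 * t 3) ^ 2 * quarticForm (y 0) (y 1) (y 2) (y 3) := by
  simp only [quart, quarticForm, fin_five_add, h.sqDist_eq]
  ring

lemma rootDeriv_zero : rootDeriv x 0 = t 0 * t 1 * t 2 * t 3 := by
  simp only [rootDeriv, fin_five_add, h.sub_eq]
  ring

lemma hess_succ :
    hess x 1 = t 0 ^ 2 * (t 0 * t 1 * t 2 * t 3) ^ 2 * hessAffine (y 0) (y 1) (y 2) (y 3) ∧
    hess x 2 = t 1 ^ 2 * (t 0 * t 1 * t 2 * t 3) ^ 2 * hessAffine (y 1) (y 0) (y 2) (y 3) ∧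
    hess x 3 = t 2 ^ 2 * (t 0 * t 1 * t 2 * t 3) ^ 2 * hessAffine (y 2) (y 0) (y 1) (y 3) ∧
    hess x 4 = t 3 ^ 2 * (t 0 * t 1 * t 2 * t 3) ^ 2 * hessAffine (y 3) (y 0) (y 1) (y 2) := by
  simp only [hess, hessForm, fin_five_add, sqDist_sort x, h.sqDist_eq, hessAffine,
    sqDist_comm (y 1) (y 0), sqDist_comm (y 2) (y 0), sqDist_comm (y 3) (y 0),
    sqDist_comm (y 2) (y 1), sqDist_comm (y 3) (y 1), sqDist_comm (y 3) (y 2)]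
  refine ⟨?_, ?_, ?_, ?_⟩ <;> ring

lemma hessProd_eq : hessProd x = (t 0 * t 1 * t 2 * t 3) ^ 12 * (sqDistSum y *
    (hessAffine (y 0) (y 1) (y 2) (y 3) * hessAffine (y 1) (y 0) (y 2) (y 3) *
      hessAffine (y 2) (y 0) (y 1) (y 3) * hessAffine (y 3) (y 0) (y 1) (y 2))) := by
  simp only [hessProd, Fin.prod_univ_five, h.hess_zero, h.hess_succ]
  ring

end IsChart

section Depressed

/-! In the chart, after a translation, the four points are the roots of `Y⁴ + p Y² + q Y + r`. -/

variable {y : Fin 4 → R} {p q r : R} (h0 : y 0 + y 1 + y 2 + y 3 = 0)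
  (hp : p = y 0 * y 1 + y 0 * y 2 + y 0 * y 3 + y 1 * y 2 + y 1 * y 3 + y 2 * y 3)
  (hq : q = -(y 0 * y 1 * y 2 + y 0 * y 1 * y 3 + y 0 * y 2 * y 3 + y 1 * y 2 * y 3))
  (hr : r = y 0 * y 1 * y 2 * y 3)
include h0 hp

lemma sqDistSum_eq : sqDistSum y = -8 * p := by
  have h3 : y 3 = -(y 0 + y 1 + y 2) := by linear_combination h0
  simp only [hp, h3, sqDistSum, sqDist]
  ring

include hr in
lemma quarticForm_eq :
    quarticForm (y 0) (y 1) (y 2) (y 3) = 2 * (12 * r + p ^ 2) := by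
  have h3 : y 3 = -(y 0 + y 1 + y 2) := by linear_combination h0
  simp only [hp, hr, h3, quarticForm, sqDist]
  ring

include hq hr

lemma pathSum_eq : pathSum y = -2 * (6 * p ^ 3 + 9 * q ^ 2 + 40 * p * r) := by
  have h3 : y 3 = -(y 0 + y 1 + y 2) := by linear_combination h0
  simp only [hp, hq, hr, h3, pathSum, sqDist]
  ring

lemma sqrtDiscFour_sq : sqrtDiscFour y ^ 2 = 16 * p ^ 4 * r - 4 * p ^ 3 * q ^ 2 -
    128 * p ^ 2 * r ^ 2 + 144 * p * q ^ 2 * r - 27 * q ^ 4 + 256 * r ^ 3 := by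
  have h3 : y 3 = -(y 0 + y 1 + y 2) := by linear_combination h0
  simp only [hp, hq, hr, h3, sqrtDiscFour_eq]
  ring

lemma hessAffine_prod :
    hessAffine (y 0) (y 1) (y 2) (y 3) * hessAffine (y 1) (y 0) (y 2) (y 3) *
      hessAffine (y 2) (y 0) (y 1) (y 3) * hessAffine (y 3) (y 0) (y 1) (y 2) =
    160000 * r ^ 4 + 55296 * q ^ 4 * r + 264960 * p * q ^ 2 * r ^ 2 + 275200 * p ^ 2 * r ^ 3 +
      5184 * p ^ 2 * q ^ 4 + 73856 * p ^ 3 * q ^ 2 * r + 144736 * p ^ 4 * r ^ 2 +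
      4656 * p ^ 5 * q ^ 2 + 22704 * p ^ 6 * r + 1089 * p ^ 8 := by
  have h3 : y 3 = -(y 0 + y 1 + y 2) := by linear_combination h0
  simp only [hp, hq, hr, h3, hessAffine, sqDist]
  ring

end Depressed

end Chart

section ChartField

variable {K : Type*} [Field K]

lemma exists_isChart {x : Fin 5 → K} (hx : Function.Injective x) (h2 : (2 : K) ≠ 0) :
    ∃ t y : Fin 4 → K, IsChart x t y ∧ y 0 + y 1 + y 2 + y 3 = 0 ∧ ∀ i, t i ≠ 0 := by
  have h4 : (4 : K) ≠ 0 := by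
    rw [show (4 : K) = 2 * 2 by norm_num]; exact mul_ne_zero h2 h2
  have ht : ∀ i : Fin 4, x i.succ - x 0 ≠ 0 := fun i h ↦
    Fin.succ_ne_zero i (hx (sub_eq_zero.mp h))
  refine ⟨fun i ↦ x i.succ - x 0, fun i ↦ (x i.succ - x 0)⁻¹ -
    ((x 1 - x 0)⁻¹ + (x 2 - x 0)⁻¹ + (x 3 - x 0)⁻¹ + (x 4 - x 0)⁻¹) / 4, ⟨fun i ↦ rfl, ?_⟩, ?_, ht⟩
  · intro i j
    have hi := ht i
    have hj := ht j
    field_simp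
    ring
  · change (x 1 - x 0)⁻¹ - _ + ((x 2 - x 0)⁻¹ - _) + ((x 3 - x 0)⁻¹ - _) +
      ((x 4 - x 0)⁻¹ - _) = 0
    field_simp
    ring

/-- The discriminant of `Y⁴ + p Y² + q Y + r`, divided by `p ^ 6`, as a polynomial in
`v = q ^ 2 / p ^ 3` and `ρ = r / p ^ 2`. -/
def discShape (v ρ : K) : K :=
  16 * ρ - 4 * v - 128 * ρ ^ 2 + 144 * v * ρ - 27 * v ^ 2 + 256 * ρ ^ 3

/-- The invariant `hessProd`, divided by `-8 * p ^ 9`, as a polynomial in `v` and `ρ`. -/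
def hessShape (v ρ : K) : K :=
  160000 * ρ ^ 4 + 55296 * v ^ 2 * ρ + 264960 * v * ρ ^ 2 + 275200 * ρ ^ 3 + 5184 * v ^ 2 +
    73856 * v * ρ + 144736 * ρ ^ 2 + 4656 * v + 22704 * ρ + 1089

/-- The invariants of five points depend, up to a scaling by `s`, on two parameters `v` and `ρ`
only, and the coordinate of the first point is an affine function of `ρ`. -/
structure HasShape (x : Fin 5 → K) (s v ρ : K) : Prop where
  s_ne_zero : s ≠ 0
  pentagonSum_eq : pentagonSum x = -2 * s * (6 + 9 * v + 40 * ρ)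
  sqrtDisc_sq : sqrtDisc x ^ 2 = s ^ 2 * discShape v ρ
  hessProd_eq : hessProd x = -8 * s ^ 3 * hessShape v ρ
  coordU_zero : coordU x 0 = -25 * (12 * ρ + 1) / 32

lemma IsChart.hasShape {x : Fin 5 → K} {t y : Fin 4 → K} (h : IsChart x t y)
    (h0 : y 0 + y 1 + y 2 + y 3 = 0) (ht : ∀ i, t i ≠ 0) (h2 : (2 : K) ≠ 0) {p q r : K}
    (hp0 : p ≠ 0)
    (hp : p = y 0 * y 1 + y 0 * y 2 + y 0 * y 3 + y 1 * y 2 + y 1 * y 3 + y 2 * y 3)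
    (hq : q = -(y 0 * y 1 * y 2 + y 0 * y 1 * y 3 + y 0 * y 2 * y 3 + y 1 * y 2 * y 3))
    (hr : r = y 0 * y 1 * y 2 * y 3) :
    HasShape x ((t 0 * t 1 * t 2 * t 3) ^ 4 * p ^ 3) (q ^ 2 / p ^ 3) (r / p ^ 2) := by
  have hT : t 0 * t 1 * t 2 * t 3 ≠ 0 :=
    mul_ne_zero (mul_ne_zero (mul_ne_zero (ht 0) (ht 1)) (ht 2)) (ht 3)
  have h32 : (32 : K) ≠ 0 := by
    rw [show (32 : K) = 2 ^ 5 by norm_num]; exact pow_ne_zero _ h2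
  have h8 : (8 : K) ≠ 0 := by
    rw [show (8 : K) = 2 ^ 3 by norm_num]; exact pow_ne_zero _ h2
  refine ⟨mul_ne_zero (pow_ne_zero _ hT) (pow_ne_zero _ hp0), ?_, ?_, ?_, ?_⟩
  · rw [h.pentagonSum_eq, pathSum_eq h0 hp hq hr]
    field_simp
  · rw [h.sqrtDisc_eq, mul_pow, sqrtDiscFour_sq h0 hp hq hr, discShape]
    field_simp
  · rw [h.hessProd_eq, sqDistSum_eq h0 hp, hessAffine_prod h0 hp hq hr, hessShape]
    field_simp
  · rw [coordU, h.hess_zero, h.quart_zero, h.rootDeriv_zero, sqDistSum_eq h0 hp,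
      quarticForm_eq h0 hp hr]
    generalize t 0 * t 1 * t 2 * t 3 = T at hT
    have hD : ((T ^ 2 * (-8 * p)) ^ 2) ≠ 0 := by
      refine pow_ne_zero _ (mul_ne_zero (pow_ne_zero _ hT) (mul_ne_zero ?_ hp0))
      exact neg_ne_zero.mpr h8
    rw [div_eq_div_iff hD h32]
    field_simp
    ring

/-- The first point yields a root of the specialized quintic. -/
lemma HasShape.eval_firstPolynomial {x : Fin 5 → K} {s v ρ : K} (h : HasShape x s v ρ)
    (h2 : (2 : K) ≠ 0) (h3 : (3 : K) ≠ 0) :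
    (firstPolynomial (pentagonSum x) ((2 * sqrtDisc x) ^ 2) (8 * hessProd x)).eval
      ((coordU x 0 - 1) / 3) = 0 := by
  have h32 : (32 : K) ≠ 0 := by
    rw [show (32 : K) = 2 ^ 5 by norm_num]; exact pow_ne_zero _ h2
  have hz : (coordU x 0 - 1) / 3 = -(100 * ρ + 19) / 32 := by
    rw [h.coordU_zero]; field_simp; ring
  rw [hz, mul_pow, h.sqrtDisc_sq, h.pentagonSum_eq, h.hessProd_eq]
  simp only [firstPolynomial, eval_add, eval_mul, eval_C, eval_pow, eval_X, discShape, hessShape]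
  field_simp
  ring

end ChartField

/-! ### The two quintics -/

section Quintics

variable {R S : Type*} [CommRing R] [CommRing S]

lemma map_firstPolynomial (f : R →+* S) (A Δ M : R) :
    (firstPolynomial A Δ M).map f = firstPolynomial (f A) (f Δ) (f M) := by
  simp only [firstPolynomial, Polynomial.map_add, Polynomial.map_mul, Polynomial.map_pow, map_C,
    Polynomial.map_sub, Polynomial.map_neg, Polynomial.map_ofNat, map_X, map_add, map_sub, map_mul,
    map_pow, map_neg, map_ofNat]

lemma map_secondPolynomial (f : R →+* S) (δ q : R) :
    (secondPolynomial δ q).map f = secondPolynomial (f δ) (f q) := by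
  simp only [secondPolynomial, Polynomial.map_add, Polynomial.map_sub, Polynomial.map_mul,
    Polynomial.map_pow, map_C, map_X, Polynomial.map_ofNat]

lemma natDegree_firstPolynomial {A Δ M : R} (h : 288 * M ^ 2 ≠ 0) :
    (firstPolynomial A Δ M).natDegree = 5 := by
  unfold firstPolynomial
  compute_degree!

lemma secondPolynomial_eq (δ q : R) : ∃ a b c d e : R, secondPolynomial δ q =
    X ^ 5 + C a * X ^ 4 + C b * X ^ 3 + C c * X ^ 2 + C d * X + C e := by
  refine ⟨150 - 20 * (611 * δ + 8505) * q + 2 * (25 + 3 * δ) * (625 * δ ^ 2 + 44550 * δ + 793881) *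
      q ^ 2, 7500 - 20 * (39270 * δ + 263250) * q + 2 * (25 + 3 * δ) * (18370800 + 3175200 * δ -
      10000 * δ ^ 2) * q ^ 2, 125000 - 20 * (4050000 + 438000 * δ) * q + 2 * (25 + 3 * δ) *
      (262440000 + 60000 * δ ^ 2 + 25336800 * δ) * q ^ 2, -2000000 * δ * q + 2 * (25 + 3 * δ) *
      (-160000 * δ ^ 2 + 12960000 * δ) * q ^ 2, 2 * (25 + 3 * δ) * (160000 * δ ^ 2) * q ^ 2, ?_⟩
  simp only [secondPolynomial, map_add, map_sub, map_mul, map_neg, map_pow, map_ofNat C]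
  ring

lemma natDegree_secondPolynomial [Nontrivial R] (δ q : R) :
    (secondPolynomial δ q).natDegree = 5 := by
  obtain ⟨a, b, c, d, e, h⟩ := secondPolynomial_eq δ q
  rw [h]
  compute_degree!

variable {K : Type*} [Field K]

/-- The first quintic is, up to the affine change of variable `u = 3 z + 1` and a constant factor,
the second one. -/
lemma eval_firstPolynomial_eq {A Δ M : K} (hA : A ≠ 0) (hM : M ≠ 0) (h2 : (2 : K) ≠ 0)
    (h3 : (3 : K) ≠ 0) (u : K) :
    243 * (firstPolynomial A Δ M).eval ((u - 1) / 3) =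
      288 * M ^ 2 * (secondPolynomial (25 * Δ / A ^ 2) (A ^ 3 / (8 * M))).eval u := by
  have h8 : (8 : K) ≠ 0 := by
    rw [show (8 : K) = 2 ^ 3 by norm_num]; exact pow_ne_zero _ h2
  simp only [firstPolynomial, secondPolynomial, eval_add, eval_sub, eval_mul, eval_C, eval_pow,
    eval_X, eval_ofNat]
  field_simp
  ring

end Quintics

section Roots

variable {K : Type*} [Field K]

lemma exists_hasShape {x : Fin 5 → K} (hx : Function.Injective x) (h2 : (2 : K) ≠ 0)
    (h : hess x 0 ≠ 0) : ∃ s v ρ : K, HasShape x s v ρ := by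
  obtain ⟨t, y, hc, h0, ht⟩ := exists_isChart hx h2
  refine ⟨_, _, _, hc.hasShape h0 ht h2 ?_ rfl rfl rfl⟩
  intro hp
  rw [hc.hess_zero, sqDistSum_eq h0 rfl, hp] at h
  simp at h

lemma sqrtDisc_comp_sq {R : Type*} [CommRing R] (x : Fin 5 → R) (σ : Equiv.Perm (Fin 5)) :
    sqrtDisc (fun i ↦ x (σ i)) ^ 2 = sqrtDisc x ^ 2 := by
  rw [sqrtDisc_comp]
  rcases Int.units_eq_one_or (Equiv.Perm.sign σ) with h | h <;> simp [h]

lemma injective_of_sqrtDisc_ne_zero {x : Fin 5 → K} (h : sqrtDisc x ≠ 0) :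
    Function.Injective x := by
  rw [sqrtDisc, ← Matrix.det_vandermonde] at h
  exact Matrix.det_vandermonde_ne_zero_iff.mp h

lemma hess_ne_zero {x : Fin 5 → K} (h : hessProd x ≠ 0) (i : Fin 5) : hess x i ≠ 0 :=
  fun hi ↦ h (Finset.prod_eq_zero (Finset.mem_univ i) hi)

variable {x : Fin 5 → K} (hx : Function.Injective x) (hM : hessProd x ≠ 0) (h2 : (2 : K) ≠ 0)
  (h3 : (3 : K) ≠ 0)
include hx hM h2 h3

/-- By symmetry it suffices to treat the first point, for which the two parameters of `HasShape`
turn the claim into a polynomial identity. -/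
lemma eval_firstPolynomial (i : Fin 5) :
    (firstPolynomial (pentagonSum x) ((2 * sqrtDisc x) ^ 2) (8 * hessProd x)).eval
      ((coordU x i - 1) / 3) = 0 := by
  have hσ : (Equiv.addRight i : Equiv.Perm (Fin 5)) 0 = i := by simp
  have h0 : hess (fun j ↦ x ((Equiv.addRight i : Equiv.Perm (Fin 5)) j)) 0 ≠ 0 := by
    rw [hess_comp]; exact hess_ne_zero hM _
  obtain ⟨s, v, ρ, h⟩ := exists_hasShape (hx.comp (Equiv.addRight i).injective) h2 h0
  have := h.eval_firstPolynomial h2 h3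
  simp only [Function.comp_def] at this
  rwa [coordU_comp, hσ, pentagonSum_comp, mul_pow, sqrtDisc_comp_sq, ← mul_pow, hessProd_comp]
    at this

lemma eval_secondPolynomial (hA : pentagonSum x ≠ 0) (i : Fin 5) :
    (secondPolynomial ((10 * sqrtDisc x / pentagonSum x) ^ 2)
      (pentagonSum x ^ 3 / (64 * hessProd x))).eval (coordU x i) = 0 := by
  have h8 : (8 : K) ≠ 0 := by
    rw [show (8 : K) = 2 ^ 3 by norm_num]; exact pow_ne_zero _ h2
  have h288 : (288 : K) ≠ 0 := by
    rw [show (288 : K) = 2 ^ 5 * 3 ^ 2 by norm_num]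
    exact mul_ne_zero (pow_ne_zero _ h2) (pow_ne_zero _ h3)
  have h := eval_firstPolynomial_eq (Δ := (2 * sqrtDisc x) ^ 2) hA (mul_ne_zero h8 hM) h2 h3
    (coordU x i)
  rw [eval_firstPolynomial hx hM h2 h3, mul_zero] at h
  have h' := (mul_eq_zero.mp h.symm).resolve_left
    (mul_ne_zero h288 (pow_ne_zero _ (mul_ne_zero h8 hM)))
  convert h' using 3 <;> ring

end Roots

/-! ### Nonvanishing of the invariants -/

/-! Each of the forms below takes, at some point with small integral coordinates, a value that has
no prime factors other than `2` and `3`. -/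

section Nonvanishing

/-- The numerator of `coordU x 0 - coordU x 1`, up to the factor `-25`. -/
def coordGap {R : Type*} [CommRing R] (x : Fin 5 → R) : R :=
  quart x 0 * rootDeriv x 0 ^ 2 * hess x 1 ^ 2 - quart x 1 * rootDeriv x 1 ^ 2 * hess x 0 ^ 2

lemma map_coordGap {R S F : Type*} [CommRing R] [CommRing S] [FunLike F R S] [RingHomClass F R S]
    (f : F) (x : Fin 5 → R) : f (coordGap x) = coordGap (fun i ↦ f (x i)) := by
  simp only [coordGap, map_sub, map_mul, map_pow, map_quart, map_rootDeriv, map_hess]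

lemma coordU_zero_ne_one {K : Type*} [Field K] {x : Fin 5 → K} (hM : hessProd x ≠ 0)
    (h5 : (5 : K) ≠ 0) (h : coordGap x ≠ 0) : coordU x 0 ≠ coordU x 1 := by
  intro h01
  have h25 : (25 : K) ≠ 0 := by
    rw [show (25 : K) = 5 ^ 2 by norm_num]; exact pow_ne_zero _ h5
  have hh0 := hess_ne_zero hM 0
  have hh1 := hess_ne_zero hM 1
  rw [coordU, coordU, div_eq_div_iff (pow_ne_zero _ hh0) (pow_ne_zero _ hh1)] at h01
  apply h
  have : 25 * coordGap x = 0 := by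
    rw [coordGap]; linear_combination -h01
  exact (mul_eq_zero.mp this).resolve_left h25

variable {F : Type*} [Field F] (h2 : (2 : F) ≠ 0)

lemma two_pow_mul_three_pow_ne_zero (h2 : (2 : F) ≠ 0) (h3 : (3 : F) ≠ 0) (a b : ℕ) :
    (2 : F) ^ a * 3 ^ b ≠ 0 :=
  mul_ne_zero (pow_ne_zero _ h2) (pow_ne_zero _ h3)

variable (F)

include h2 in
lemma pentagonSum_X_ne_zero :
    pentagonSum (MvPolynomial.X : Fin 5 → MvPolynomial (Fin 5) F) ≠ 0 := by
  intro h
  have := congrArg (MvPolynomial.aeval (![0, 0, 1, 1, 2] : Fin 5 → F)) h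
  rw [map_pentagonSum, map_zero] at this
  simp only [MvPolynomial.aeval_X, pentagonSum, sqDist] at this
  apply pow_ne_zero 4 h2
  rw [← this]
  simp
  norm_num

include h2 in
lemma sqrtDisc_X_ne_zero (h3 : (3 : F) ≠ 0) :
    sqrtDisc (MvPolynomial.X : Fin 5 → MvPolynomial (Fin 5) F) ≠ 0 := by
  intro h
  have := congrArg (MvPolynomial.aeval (![0, 1, 2, 3, 4] : Fin 5 → F)) h
  rw [map_sqrtDisc, map_zero] at this
  simp only [MvPolynomial.aeval_X, sqrtDisc_eq] at this
  apply two_pow_mul_three_pow_ne_zero h2 h3 5 2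
  rw [← this]
  simp
  norm_num

include h2 in
lemma hessProd_X_ne_zero (h3 : (3 : F) ≠ 0) :
    hessProd (MvPolynomial.X : Fin 5 → MvPolynomial (Fin 5) F) ≠ 0 := by
  intro h
  have := congrArg (MvPolynomial.aeval (![0, 0, 1, 1, 2] : Fin 5 → F)) h
  rw [map_hessProd, map_zero] at this
  simp only [MvPolynomial.aeval_X, hessProd, Fin.prod_univ_five, hess, hessForm, fin_five_add,
    sqDist] at this
  apply two_pow_mul_three_pow_ne_zero h2 h3 8 4
  rw [← this]
  simp
  norm_num

include h2 in
lemma coordGap_X_ne_zero (h3 : (3 : F) ≠ 0) :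
    coordGap (MvPolynomial.X : Fin 5 → MvPolynomial (Fin 5) F) ≠ 0 := by
  intro h
  have := congrArg (MvPolynomial.aeval (![0, -1, 0, 1, 1] : Fin 5 → F)) h
  rw [map_coordGap, map_zero] at this
  simp only [MvPolynomial.aeval_X, coordGap, quart, quarticForm, rootDeriv, hess, hessForm,
    fin_five_add, sqDist] at this
  apply two_pow_mul_three_pow_ne_zero h2 h3 5 2
  rw [← neg_eq_zero, ← this]
  simp
  norm_num

include h2 in
lemma pentagonSum_sq_add_X_ne_zero :
    pentagonSum (MvPolynomial.X : Fin 5 → MvPolynomial (Fin 5) F) ^ 2 +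
      12 * sqrtDisc .X ^ 2 ≠ 0 := by
  intro h
  have := congrArg (MvPolynomial.aeval (![0, 0, 1, 1, 2] : Fin 5 → F)) h
  rw [map_add, map_pow, map_mul, map_pow, map_pentagonSum, map_sqrtDisc, map_zero] at this
  simp only [MvPolynomial.aeval_X, pentagonSum, sqDist, sqrtDisc_eq] at this
  apply pow_ne_zero 8 h2
  rw [← this]
  simp
  norm_num

end Nonvanishing

/-! ### Extensions with Galois group `A₅` -/

section Group

lemma alternatingGroup_exists_map_pair {i j k l : Fin 5} (hij : i ≠ j) (hkl : k ≠ l) :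
    ∃ g : alternatingGroup (Fin 5), (g : Equiv.Perm (Fin 5)) i = k ∧
      (g : Equiv.Perm (Fin 5)) j = l := by
  have h := alternatingGroup.isMultiplyPretransitive (Fin 5)
  have h2 : MulAction.IsMultiplyPretransitive (alternatingGroup (Fin 5)) (Fin 5) 2 := by
    refine MulAction.isMultiplyPretransitive_of_le' (n := Nat.card (Fin 5) - 2) ?_ ?_ <;>
      norm_num [Nat.card_eq_fintype_card]
  rw [MulAction.is_two_pretransitive_iff] at h2
  obtain ⟨g, hg⟩ := h2 hij hkl
  exact ⟨g, hg⟩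

lemma alternatingGroup_not_isCyclic : ¬ IsCyclic (alternatingGroup (Fin 5)) := by
  intro h
  have hc := h.isMulCommutative
  have hm : ∀ a b c : Fin 5, a ≠ b → b ≠ c → a ≠ c →
      Equiv.swap a b * Equiv.swap b c ∈ alternatingGroup (Fin 5) := by
    intro a b c hab hbc _
    rw [Equiv.Perm.mem_alternatingGroup, map_mul, Equiv.Perm.sign_swap hab,
      Equiv.Perm.sign_swap hbc]
    rfl
  have h1 := hc.is_comm.comm ⟨_, hm 0 1 2 (by decide) (by decide) (by decide)⟩
    ⟨_, hm 2 3 4 (by decide) (by decide) (by decide)⟩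
  have h2 : ((Equiv.swap 0 1 * Equiv.swap 1 2) * (Equiv.swap 2 3 * Equiv.swap 3 4) :
      Equiv.Perm (Fin 5)) 2 = ((Equiv.swap 2 3 * Equiv.swap 3 4) *
        (Equiv.swap 0 1 * Equiv.swap 1 2) : Equiv.Perm (Fin 5)) 2 :=
    congrArg (fun g : alternatingGroup (Fin 5) ↦ (g : Equiv.Perm (Fin 5)) 2) h1
  exact absurd h2 (by decide)

end Group

section Extension

variable {K L : Type*} [Field K] [Field L] [Algebra K L]

/-- Galois groups over finite fields are cyclic. -/
lemma infinite_of_gal [FiniteDimensional K L]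
    (e : (L ≃ₐ[K] L) ≃* alternatingGroup (Fin 5)) : Infinite K := by
  by_contra hK
  have : Finite K := not_infinite_iff_finite.mp hK
  have : Finite L := Module.finite_of_finite K
  exact alternatingGroup_not_isCyclic (isCyclic_of_surjective e e.surjective)

/-- Five elements of `L` are permuted by `A₅`, acting through `s`, in the same way as the five
indices. -/
def IsEquivariant (s : alternatingGroup (Fin 5) →* (L ≃ₐ[K] L)) (x : Fin 5 → L) : Prop :=
  ∀ g i, s g (x i) = x ((g : Equiv.Perm (Fin 5)) i)

lemma IsEquivariant.injective {s : alternatingGroup (Fin 5) →* (L ≃ₐ[K] L)} {z : Fin 5 → L}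
    (hz : IsEquivariant s z) (h01 : z 0 ≠ z 1) : Function.Injective z := by
  intro i j hij
  by_contra hne
  obtain ⟨g, hgi, hgj⟩ := alternatingGroup_exists_map_pair hne (zero_ne_one (α := Fin 5))
  apply h01
  rw [← hgi, ← hgj, ← hz g i, ← hz g j, hij]

lemma IsEquivariant.coordU {s : alternatingGroup (Fin 5) →* (L ≃ₐ[K] L)} {x : Fin 5 → L}
    (hx : IsEquivariant s x) : IsEquivariant s (coordU x) := by
  intro g i
  rw [map_coordU, ← coordU_comp]
  simp only [hx g]

/-- Equivariance for an isomorphism of the Galois group with `A₅`, in terms of automorphisms. -/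
lemma IsEquivariant.apply_eq {e : (L ≃ₐ[K] L) ≃* alternatingGroup (Fin 5)} {x : Fin 5 → L}
    (hx : IsEquivariant e.symm.toMonoidHom x) (g : L ≃ₐ[K] L) (i : Fin 5) :
    g (x i) = x ((e g : Equiv.Perm (Fin 5)) i) := by
  simpa using hx (e g) i

variable (e : (L ≃ₐ[K] L) ≃* alternatingGroup (Fin 5))

/-- The traces of a generator of a normal basis over the cosets of a point stabilizer are five
distinct conjugate elements. -/
lemma exists_injective_isEquivariant [FiniteDimensional K L] :
    ∃ x : Fin 5 → L, Function.Injective x ∧ IsEquivariant e.symm.toMonoidHom x := by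
  classical
  obtain ⟨b, hb⟩ := exists_linearIndependent_algEquiv_apply K L
  let act (g : L ≃ₐ[K] L) (i : Fin 5) : Fin 5 := (e g : Equiv.Perm (Fin 5)) i
  refine ⟨fun i ↦ ∑ g : L ≃ₐ[K] L, if act g 0 = i then g b else 0, ?_, ?_⟩
  · intro i j hij
    by_contra hne
    obtain ⟨g, hg, -⟩ := alternatingGroup_exists_map_pair (i := 0) (j := 1) (k := i)
      (l := i + 1) (by decide) (by simp)
    have hsum : ∑ g : L ≃ₐ[K] L, ((if act g 0 = i then (1 : K) else 0) -
        (if act g 0 = j then 1 else 0)) • g b = 0 := by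
      rw [← sub_eq_zero, ← Finset.sum_sub_distrib] at hij
      rw [← hij]
      refine Finset.sum_congr rfl fun g _ ↦ ?_
      split_ifs <;> simp
    have := Fintype.linearIndependent_iff.mp hb _ hsum (e.symm g)
    have hact : act (e.symm g) 0 = i := by simp only [act, MulEquiv.apply_symm_apply, hg]
    rw [hact, if_pos rfl, if_neg hne] at this
    simp at this
  · intro h' i
    obtain ⟨h, rfl⟩ := e.surjective h'
    simp only [MulEquiv.toMonoidHom_eq_coe, MonoidHom.coe_coe, MulEquiv.symm_apply_apply]
    simp only [map_sum, apply_ite h, map_zero]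
    refine Fintype.sum_equiv (Equiv.mulLeft h) _ _ fun g ↦ ?_
    have : act (h * g) 0 = (e h : Equiv.Perm (Fin 5)) i ↔ act g 0 = i := by
      simp only [act, map_mul, Subgroup.coe_mul, Equiv.Perm.mul_apply]
      exact (e h : Equiv.Perm (Fin 5)).injective.eq_iff
    simp only [Equiv.coe_mulLeft, AlgEquiv.mul_apply, act] at this ⊢
    simp only [this]

/-- Equivariant tuples are Zariski dense: a polynomial condition that is not identically violated
holds for one of them. -/
lemma exists_isEquivariant_eval_ne_zero [FiniteDimensional K L] {W : MvPolynomial (Fin 5) L}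
    (hW : W ≠ 0) :
    ∃ x : Fin 5 → L, IsEquivariant e.symm.toMonoidHom x ∧ MvPolynomial.eval x W ≠ 0 := by
  obtain ⟨θ, hθ, hθe⟩ := exists_injective_isEquivariant e
  have := infinite_of_gal e
  let V := Matrix.vandermonde θ
  have hV : V * V⁻¹ = 1 :=
    Matrix.mul_nonsing_inv V (isUnit_iff_ne_zero.mpr (Matrix.det_vandermonde_ne_zero_iff.mpr hθ))
  let φ : MvPolynomial (Fin 5) L →ₐ[L] MvPolynomial (Fin 5) L :=
    MvPolynomial.aeval fun i ↦ ∑ k, MvPolynomial.C (V i k) * MvPolynomial.X k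
  let ψ : MvPolynomial (Fin 5) L →ₐ[L] MvPolynomial (Fin 5) L :=
    MvPolynomial.aeval fun i ↦ ∑ k, MvPolynomial.C (V⁻¹ i k) * MvPolynomial.X k
  -- `φ` is the linear substitution with matrix `V`, so that it is injective
  have hψφ : ψ.comp φ = AlgHom.id L _ := by
    ext1 i
    simp only [φ, ψ, AlgHom.comp_apply, MvPolynomial.aeval_X, map_sum, map_mul,
      MvPolynomial.aeval_C, AlgHom.id_apply, MvPolynomial.algebraMap_eq, Finset.mul_sum]
    rw [Finset.sum_comm]
    simp only [← mul_assoc, ← MvPolynomial.C_mul, ← Finset.sum_mul, ← map_sum, ← Matrix.mul_apply,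
      hV, Matrix.one_apply]
    simp [apply_ite MvPolynomial.C, ite_mul]
  have hφW : φ W ≠ 0 := fun h ↦ hW <| by
    rw [← AlgHom.id_apply (R := L) W, ← hψφ, AlgHom.comp_apply, h, map_zero]
  obtain ⟨c, hc⟩ : ∃ c : Fin 5 → K,
      MvPolynomial.eval (fun k ↦ algebraMap K L (c k)) (φ W) ≠ 0 := by
    by_contra! h
    refine hφW (MvPolynomial.funext_set (fun _ ↦ Set.range (algebraMap K L))
      (fun _ ↦ Set.infinite_range_of_injective (algebraMap K L).injective) fun x hx ↦ ?_)
    choose c hc using fun k ↦ hx k (Set.mem_univ k)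
    rw [map_zero, ← h c]
    simp only [hc]
  refine ⟨fun i ↦ ∑ k : Fin 5, θ i ^ (k : ℕ) * algebraMap K L (c k), fun g i ↦ ?_, ?_⟩
  · simp only [map_sum, map_mul, map_pow, AlgEquiv.commutes]
    rw [hθe]
  · convert hc using 1
    rw [← MvPolynomial.coe_aeval_eq_eval, ← MvPolynomial.coe_aeval_eq_eval]
    simp only [RingHom.coe_coe, φ, ← AlgHom.comp_apply, MvPolynomial.comp_aeval]
    simp [V, Matrix.vandermonde_apply]

variable {e}

lemma splits_of_roots {n : ℕ} {Q : K[X]} (hQ0 : Q ≠ 0) (hQ : Q.natDegree = n) {z : Fin n → L}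
    (hz : Function.Injective z) (hroot : ∀ i, aeval (z i) Q = 0) :
    (Q.map (algebraMap K L)).Splits ∧ Q.Separable ∧ Q.rootSet L = Set.range z := by
  classical
  have hsub : Set.range z ⊆ Q.rootSet L := by
    rintro _ ⟨i, rfl⟩
    exact mem_rootSet.mpr ⟨hQ0, hroot i⟩
  have hcard : (Set.range z).ncard = n := by
    rw [← Set.image_univ, Set.ncard_image_of_injective _ hz, Set.ncard_univ, Nat.card_fin]
  have hle : (Q.rootSet L).ncard ≤ n := hQ ▸ ncard_rootSet_le Q L
  have heq : Q.rootSet L = Set.range z :=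
    (Set.eq_of_subset_of_ncard_le hsub (hle.trans hcard.ge) (rootSet_finite Q L)).symm
  have hs : (Q.map (algebraMap K L)).Splits := by
    rw [splits_iff_card_roots, natDegree_map, hQ]
    refine le_antisymm ((card_roots' _).trans (by rw [natDegree_map, hQ])) ?_
    rw [← hcard, ← heq, rootSet, Set.ncard_coe_finset]
    exact Multiset.toFinset_card_le _
  refine ⟨hs, ?_, heq⟩
  rw [← card_rootSet_eq_natDegree_iff_of_splits hQ0 hs, hQ, ← Nat.card_eq_fintype_card,
    Nat.card_coe_set_eq, heq, hcard]

/-- The action of `A₅` on the roots is faithful, so that they generate `L`. -/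
lemma IsEquivariant.isSplittingField [FiniteDimensional K L] [IsGalois K L] {z : Fin 5 → L}
    (hz : IsEquivariant e.symm.toMonoidHom z) (h01 : z 0 ≠ z 1) {Q : K[X]} (hQ : Q.natDegree = 5)
    (hroot : ∀ i, aeval (z i) Q = 0) : Q.IsSplittingField K L := by
  have hinj := hz.injective h01
  have hQ0 : Q ≠ 0 := fun h ↦ by simp [h] at hQ
  rw [isSplittingField_iff_intermediateField]
  refine ⟨(splits_of_roots hQ0 hQ hinj hroot).1, ?_⟩
  rw [← IsGalois.fixedField_fixingSubgroup (IntermediateField.adjoin K (Q.rootSet L)),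
    ← IntermediateField.fixedField_bot]
  congr 1
  rw [eq_bot_iff]
  intro g hg
  rw [Subgroup.mem_bot]
  apply e.injective
  rw [map_one]
  ext i : 2
  apply hinj
  rw [← hz.apply_eq]
  exact (IntermediateField.mem_fixingSubgroup_iff _ g).mp hg _
    (IntermediateField.subset_adjoin K _ (mem_rootSet.mpr ⟨hQ0, hroot i⟩))

end Extension

/-! ### Every `A₅`-extension is a specialization -/


section Specialization

/-- Polynomial coefficients are specialized by evaluation. -/
lemma specializesTo_map {F : Type} [Field F] {m : ℕ} (P : (MvPolynomial (Fin m) F)[X])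
    {K : Type*} [Field K] [Algebra F K] (τ : Fin m → K) :
    SpecializesTo (P.map (algebraMap _ (RatFunField F m))) τ
      (P.map (MvPolynomial.aeval τ : MvPolynomial (Fin m) F →ₐ[F] K).toRingHom) := by
  intro n
  refine ⟨P.coeff n, 1, ?_, ?_, ?_⟩ <;> simp

/-- A polynomial with integral coefficients reduces coefficientwise. -/
lemma reducesTo_map (p : ℕ) [Fact p.Prime] {m : ℕ} (P : (MvPolynomial (Fin m) ℤ)[X]) :
    ReducesTo p
      (P.map ((algebraMap _ (RatFunField ℚ m)).comp (MvPolynomial.map (Int.castRingHom ℚ))))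
      (P.map ((algebraMap _ (RatFunField (ZMod p) m)).comp
        (MvPolynomial.map (Int.castRingHom (ZMod p))))) := by
  intro n
  refine ⟨P.coeff n, 1, ?_, ?_, ?_⟩ <;> simp

variable {F : Type} [Field F]

lemma firstPolynomial_specializesTo {K : Type*} [Field K] [Algebra F K] (a d m : K) :
    SpecializesTo
      (firstPolynomial (indet F (0 : Fin 3)) (indet F (1 : Fin 3) ^ 2) (indet F (2 : Fin 3)))
      ![a, d, m] (firstPolynomial a (d ^ 2) m) := by
  have := specializesTo_map (firstPolynomial (MvPolynomial.X (0 : Fin 3) : MvPolynomial (Fin 3) F)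
    (MvPolynomial.X 1 ^ 2) (MvPolynomial.X 2)) ![a, d, m]
  simpa only [map_firstPolynomial, map_pow, AlgHom.toRingHom_eq_coe, RingHom.coe_coe,
    MvPolynomial.aeval_X, Matrix.cons_val_zero, Matrix.cons_val_one, Matrix.cons_val, indet]
    using this

lemma secondPolynomial_specializesTo {K : Type*} [Field K] [Algebra F K] (d q : K) :
    SpecializesTo (secondPolynomial (indet F (0 : Fin 2) ^ 2) (indet F (1 : Fin 2)))
      ![d, q] (secondPolynomial (d ^ 2) q) := by
  have := specializesTo_map (secondPolynomial
    (MvPolynomial.X (0 : Fin 2) ^ 2 : MvPolynomial (Fin 2) F) (MvPolynomial.X 1)) ![d, q]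
  simpa only [map_secondPolynomial, map_pow, AlgHom.toRingHom_eq_coe, RingHom.coe_coe,
    MvPolynomial.aeval_X, Matrix.cons_val_zero, Matrix.cons_val_one, Matrix.cons_val, indet]
    using this

lemma firstPolynomial_reducesTo (p : ℕ) [Fact p.Prime] :
    ReducesTo p
      (firstPolynomial (indet ℚ (0 : Fin 3)) (indet ℚ (1 : Fin 3) ^ 2) (indet ℚ (2 : Fin 3)))
      (firstPolynomial (indet (ZMod p) (0 : Fin 3)) (indet (ZMod p) (1 : Fin 3) ^ 2)
        (indet (ZMod p) (2 : Fin 3))) := by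
  have := reducesTo_map p (firstPolynomial
    (MvPolynomial.X (0 : Fin 3) : MvPolynomial (Fin 3) ℤ) (MvPolynomial.X 1 ^ 2)
    (MvPolynomial.X 2))
  simpa only [map_firstPolynomial, map_pow, RingHom.comp_apply, MvPolynomial.map_X, indet]
    using this

lemma secondPolynomial_reducesTo (p : ℕ) [Fact p.Prime] :
    ReducesTo p (secondPolynomial (indet ℚ (0 : Fin 2) ^ 2) (indet ℚ (1 : Fin 2)))
      (secondPolynomial (indet (ZMod p) (0 : Fin 2) ^ 2) (indet (ZMod p) (1 : Fin 2))) := by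
  have := reducesTo_map p (secondPolynomial
    (MvPolynomial.X (0 : Fin 2) ^ 2 : MvPolynomial (Fin 2) ℤ) (MvPolynomial.X 1))
  simpa only [map_secondPolynomial, map_pow, RingHom.comp_apply, MvPolynomial.map_X, indet]
    using this

end Specialization

section Parametrization

lemma algebraMap_ofNat_ne_zero {F K : Type*} [Field F] [Field K] [Algebra F K] {n : ℕ}
    [n.AtLeastTwo] (h : (ofNat(n) : F) ≠ 0) : (ofNat(n) : K) ≠ 0 := by
  rw [← map_ofNat (algebraMap F K) n]
  exact (_root_.map_ne_zero _).mpr h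

/-- Every `A₅`-extension comes from an equivariant five-tuple in general position, whose invariants
lie in the base field. -/
lemma exists_isEquivariant_invariants {K L : Type*} [Field K] [Field L] [Algebra K L]
    [FiniteDimensional K L] [IsGalois K L] (e : (L ≃ₐ[K] L) ≃* alternatingGroup (Fin 5))
    (h2 : (2 : L) ≠ 0) (h3 : (3 : L) ≠ 0) (h5 : (5 : L) ≠ 0) :
    ∃ (x : Fin 5 → L) (a d m : K), IsEquivariant e.symm.toMonoidHom x ∧ Function.Injective x ∧
      coordU x 0 ≠ coordU x 1 ∧ a ≠ 0 ∧ m ≠ 0 ∧ pentagonSum x = algebraMap K L a ∧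
      sqrtDisc x = algebraMap K L d ∧ hessProd x = algebraMap K L m := by
  obtain ⟨x, hx, hW⟩ := exists_isEquivariant_eval_ne_zero e (mul_ne_zero (mul_ne_zero
    (pentagonSum_X_ne_zero L h2) (sqrtDisc_X_ne_zero L h2 h3)) (mul_ne_zero
    (hessProd_X_ne_zero L h2 h3) (coordGap_X_ne_zero L h2 h3)))
  simp only [map_mul, map_pentagonSum, map_sqrtDisc, map_hessProd, map_coordGap,
    MvPolynomial.eval_X, mul_ne_zero_iff] at hW
  obtain ⟨⟨hA, hD⟩, hM, hG⟩ := hW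
  have mem : ∀ y : L, (∀ g : L ≃ₐ[K] L, g y = y) → ∃ k, y = algebraMap K L k := by
    intro y hy
    obtain ⟨k, hk⟩ := (IsGalois.mem_range_algebraMap_iff_fixed y).mpr hy
    exact ⟨k, hk.symm⟩
  obtain ⟨a, ha⟩ := mem (pentagonSum x) fun g ↦ by
    rw [map_pentagonSum]; simp only [hx.apply_eq g, pentagonSum_comp]
  obtain ⟨d, hd⟩ := mem (sqrtDisc x) fun g ↦ by
    rw [map_sqrtDisc]
    simp only [hx.apply_eq g]
    rw [sqrtDisc_comp, Equiv.Perm.mem_alternatingGroup.mp (e g).2]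
    simp
  obtain ⟨m, hm⟩ := mem (hessProd x) fun g ↦ by
    rw [map_hessProd]; simp only [hx.apply_eq g, hessProd_comp]
  refine ⟨x, a, d, m, hx, injective_of_sqrtDisc_ne_zero hD, coordU_zero_ne_one hM h5 hG, ?_, ?_,
    ha, hd, hm⟩
  · rintro rfl; exact hA (by rw [ha, map_zero])
  · rintro rfl; exact hM (by rw [hm, map_zero])

variable {F : Type} [Field F] (h2 : (2 : F) ≠ 0) (h3 : (3 : F) ≠ 0) (h5 : (5 : F) ≠ 0)
include h2 h3 h5

lemma firstPolynomial_parametrizesExtensions :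
    ParametrizesExtensions.{u, v}
      (firstPolynomial (indet F (0 : Fin 3)) (indet F (1 : Fin 3) ^ 2) (indet F (2 : Fin 3)))
      (alternatingGroup (Fin 5)) := by
  intro K _ _ L _ _ _ _ ⟨e⟩
  have k2 : (2 : K) ≠ 0 := algebraMap_ofNat_ne_zero h2
  have k3 : (3 : K) ≠ 0 := algebraMap_ofNat_ne_zero h3
  have k5 : (5 : K) ≠ 0 := algebraMap_ofNat_ne_zero h5
  have l2 : (2 : L) ≠ 0 := algebraMap_ofNat_ne_zero k2
  have l3 : (3 : L) ≠ 0 := algebraMap_ofNat_ne_zero k3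
  obtain ⟨x, a, d, m, hx, hinj, h01, ha0, hm0, ha, hd, hm⟩ :=
    exists_isEquivariant_invariants e l2 l3 (algebraMap_ofNat_ne_zero k5)
  refine ⟨_, _, firstPolynomial_specializesTo a (2 * d) (8 * m), ?_⟩
  have hz : IsEquivariant e.symm.toMonoidHom fun i ↦ (coordU x i - 1) / 3 := by
    intro g i
    rw [map_div₀, map_sub, map_one, map_ofNat, hx.coordU]
  refine hz.isSplittingField (fun h ↦ h01 ?_) (natDegree_firstPolynomial ?_) fun i ↦ ?_
  · have := (div_left_inj' l3).mp h
    linear_combination this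
  · rw [show 288 * (8 * m) ^ 2 = 2 ^ 11 * 3 ^ 2 * m ^ 2 by ring]
    exact mul_ne_zero (two_pow_mul_three_pow_ne_zero k2 k3 _ _) (pow_ne_zero _ hm0)
  · rw [← eval_map_algebraMap, map_firstPolynomial, map_pow, map_mul, map_mul, map_ofNat,
      map_ofNat, ← ha, ← hd, ← hm]
    refine eval_firstPolynomial hinj ?_ l2 l3 i
    rw [hm]
    exact (_root_.map_ne_zero _).mpr hm0

lemma secondPolynomial_parametrizesExtensions :
    ParametrizesExtensions.{u, v}
      (secondPolynomial (indet F (0 : Fin 2) ^ 2) (indet F (1 : Fin 2)))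
      (alternatingGroup (Fin 5)) := by
  intro K _ _ L _ _ _ _ ⟨e⟩
  have k2 : (2 : K) ≠ 0 := algebraMap_ofNat_ne_zero h2
  have k3 : (3 : K) ≠ 0 := algebraMap_ofNat_ne_zero h3
  have k5 : (5 : K) ≠ 0 := algebraMap_ofNat_ne_zero h5
  have l2 : (2 : L) ≠ 0 := algebraMap_ofNat_ne_zero k2
  have l3 : (3 : L) ≠ 0 := algebraMap_ofNat_ne_zero k3
  obtain ⟨x, a, d, m, hx, hinj, h01, ha0, hm0, ha, hd, hm⟩ :=
    exists_isEquivariant_invariants e l2 l3 (algebraMap_ofNat_ne_zero k5)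
  refine ⟨_, _, secondPolynomial_specializesTo (10 * d / a) (a ^ 3 / (64 * m)), ?_⟩
  refine hx.coordU.isSplittingField h01 (natDegree_secondPolynomial _ _) fun i ↦ ?_
  rw [← eval_map_algebraMap, map_secondPolynomial]
  simp only [map_pow, map_mul, map_div₀, map_ofNat, ← ha, ← hd, ← hm]
  refine eval_secondPolynomial hinj ?_ l2 l3 ?_ i
  · rw [hm]
    exact (_root_.map_ne_zero _).mpr hm0
  · rw [ha]
    exact (_root_.map_ne_zero _).mpr ha0

end Parametrization

/-! ### Galois groups of quintics and quartics -/

section GaloisGroup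

variable {k E : Type*} [Field k] [Field E] [Algebra k E]

/-- A quintic whose five distinct roots are permuted transitively is irreducible. -/
lemma minpoly_natDegree_of_isEquivariant {s : alternatingGroup (Fin 5) →* (E ≃ₐ[k] E)}
    {w : Fin 5 → E} (hw : IsEquivariant s w) (h01 : w 0 ≠ w 1) {P : k[X]} (hP : P.natDegree = 5)
    (hroot : ∀ i, aeval (w i) P = 0) :
    Irreducible P ∧ P.Separable ∧ IsIntegral k (w 0) ∧ (minpoly k (w 0)).natDegree = 5 := by
  have hinj := hw.injective h01
  have hP0 : P ≠ 0 := fun h ↦ by simp [h] at hP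
  have hint : IsIntegral k (w 0) := isAlgebraic_iff_isIntegral.mp ⟨P, hP0, hroot 0⟩
  have hroot' : ∀ i, aeval (w i) (minpoly k (w 0)) = 0 := by
    intro i
    obtain ⟨g, hg, -⟩ := alternatingGroup_exists_map_pair (i := 0) (j := 1) (k := i)
      (l := i + 1) (by decide) (by simp)
    rw [← hg, ← hw, aeval_algHom_apply, minpoly.aeval, map_zero]
  have hdvd : minpoly k (w 0) ∣ P := minpoly.dvd k _ (hroot 0)
  have hdeg : 5 ≤ (minpoly k (w 0)).natDegree := by
    have hsub : Set.range w ⊆ (minpoly k (w 0)).rootSet E := by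
      rintro _ ⟨i, rfl⟩
      exact mem_rootSet.mpr ⟨minpoly.ne_zero hint, hroot' i⟩
    calc 5 = (Set.range w).ncard := by
          rw [← Set.image_univ, Set.ncard_image_of_injective _ hinj, Set.ncard_univ, Nat.card_fin]
      _ ≤ ((minpoly k (w 0)).rootSet E).ncard := Set.ncard_le_ncard hsub (rootSet_finite _ E)
      _ ≤ _ := ncard_rootSet_le _ E
  have hdeg5 : (minpoly k (w 0)).natDegree = 5 :=
    le_antisymm ((natDegree_le_of_dvd hdvd hP0).trans hP.le) hdeg
  have hass : Associated (minpoly k (w 0)) P :=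
    associated_of_dvd_of_natDegree_le hdvd hP0 (by rw [hP, hdeg5])
  exact ⟨hass.irreducible (minpoly.irreducible hint), (splits_of_roots hP0 hP hinj hroot).2.1,
    hint, hdeg5⟩

/-- A quintic whose roots are permuted equivariantly by `A₅` and generate an extension of degree at
most `60` has Galois group `A₅`. -/
lemma gal_equiv_alternatingGroup {s : alternatingGroup (Fin 5) →* (E ≃ₐ[k] E)}
    {w : Fin 5 → E} (hw : IsEquivariant s w) (h01 : w 0 ≠ w 1) {P : k[X]} (hP : P.natDegree = 5)
    (hroot : ∀ i, aeval (w i) P = 0)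
    (hrank : Module.finrank k (IntermediateField.adjoin k (P.rootSet E)) ≤ 60) :
    Nonempty (P.Gal ≃* alternatingGroup (Fin 5)) := by
  have hinj := hw.injective h01
  have hP0 : P ≠ 0 := fun h ↦ by simp [h] at hP
  obtain ⟨-, hsep, -, -⟩ := minpoly_natDegree_of_isEquivariant hw h01 hP hroot
  have hs := (splits_of_roots hP0 hP hinj hroot).1
  have : Fact ((P.map (algebraMap k E)).Splits) := ⟨hs⟩
  let Φ : alternatingGroup (Fin 5) →* P.Gal := (Gal.restrict P E).comp s
  have hΦ : Function.Injective Φ := by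
    rw [injective_iff_map_eq_one]
    intro g hg
    ext i : 2
    apply hinj
    have h := Gal.restrict_smul (p := P) (E := E) (s g) ⟨w i, mem_rootSet.mpr ⟨hP0, hroot i⟩⟩
    have hg' : Gal.restrict P E (s g) = 1 := hg
    rw [hg', one_smul, hw] at h
    exact h.symm
  have hcard : Nat.card P.Gal ≤ Nat.card (alternatingGroup (Fin 5)) := by
    have h60 : Nat.card (alternatingGroup (Fin 5)) = 60 := by
      rw [nat_card_alternatingGroup]; simp [Nat.factorial]
    have := IntermediateField.adjoin_rootSet_isSplittingField hs
    rw [Gal.card_of_separable hsep, h60, ← LinearEquiv.finrank_eq (IsSplittingField.algEquiv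
      (IntermediateField.adjoin k (P.rootSet E)) P).toLinearEquiv]
    exact hrank
  exact ⟨(MulEquiv.ofBijective Φ (hΦ.bijective_of_nat_card_le hcard)).symm⟩

/-- If the square root of the discriminant of a quartic lies in the base field, then its splitting
field has degree at most `12`. -/
lemma finrank_adjoin_le_twelve {y : Fin 4 → E} (hy : Function.Injective y) (h2 : (2 : E) ≠ 0)
    {T : k[X]} (hT : T.natDegree = 4) (hroot : ∀ i, aeval (y i) T = 0) {c : k}
    (hc : algebraMap k E c = sqrtDiscFour y) :
    FiniteDimensional k (IntermediateField.adjoin k (Set.range y)) ∧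
      Module.finrank k (IntermediateField.adjoin k (Set.range y)) ≤ 12 := by
  have hT0 : T ≠ 0 := fun h ↦ by simp [h] at hT
  obtain ⟨hs, hsep, hrootSet⟩ := splits_of_roots hT0 hT hy hroot
  have hsf := IntermediateField.adjoin_rootSet_isSplittingField hs
  rw [hrootSet] at hsf
  have hfin : FiniteDimensional k (IntermediateField.adjoin k (Set.range y)) :=
    IsSplittingField.finiteDimensional _ T
  have hgal : IsGalois k (IntermediateField.adjoin k (Set.range y)) :=
    IsGalois.of_separable_splitting_field hsep
  refine ⟨hfin, ?_⟩
  let Λ := IntermediateField.adjoin k (Set.range y)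
  have hmem : ∀ i, y i ∈ Λ := fun i ↦ IntermediateField.subset_adjoin k _ ⟨i, rfl⟩
  -- every automorphism permutes the four roots, and the permutation is even
  have hperm : ∀ g : Λ ≃ₐ[k] Λ, ∃ π : alternatingGroup (Fin 4),
      ∀ i, ((g ⟨y i, hmem i⟩ : Λ) : E) = y ((π : Equiv.Perm (Fin 4)) i) := by
    intro g
    have hex : ∀ i, ∃ j, y j = ((g ⟨y i, hmem i⟩ : Λ) : E) := by
      intro i
      have : ((g ⟨y i, hmem i⟩ : Λ) : E) ∈ T.rootSet E := by
        rw [mem_rootSet]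
        refine ⟨hT0, ?_⟩
        have h1 : aeval (⟨y i, hmem i⟩ : Λ) T = 0 := by
          apply Subtype.val_injective
          rw [← IntermediateField.coe_val, ← aeval_algHom_apply]
          simpa using hroot i
        rw [← IntermediateField.coe_val, aeval_algHom_apply, ← AlgEquiv.coe_toAlgHom,
          aeval_algHom_apply, h1, map_zero, map_zero]
      rw [hrootSet] at this
      exact this
    choose π hπ using hex
    have hπinj : Function.Injective π := by
      intro i j hij
      have h1 := hπ i
      rw [hij, hπ j] at h1
      exact hy (congrArg Subtype.val (g.injective (Subtype.ext h1.symm)))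
    let σ : Equiv.Perm (Fin 4) := Equiv.ofBijective π (Finite.injective_iff_bijective.mp hπinj)
    have hV : sqrtDiscFour y ≠ 0 := by
      rw [sqrtDiscFour, ← Matrix.det_vandermonde]
      exact Matrix.det_vandermonde_ne_zero_iff.mpr hy
    have hVσ : sqrtDiscFour (fun i ↦ y (σ i)) = (Equiv.Perm.sign σ : ℤ) * sqrtDiscFour y := by
      simp only [sqrtDiscFour, ← Matrix.det_vandermonde]
      exact_mod_cast Matrix.det_permute σ (Matrix.vandermonde y)
    have hVg : sqrtDiscFour (fun i ↦ y (σ i)) = sqrtDiscFour y := by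
      have h1 : algebraMap k Λ c = ∏ i, ∏ j ∈ Finset.Ioi i,
          ((⟨y j, hmem j⟩ : Λ) - ⟨y i, hmem i⟩) := by
        apply (algebraMap Λ E).injective
        rw [← IsScalarTower.algebraMap_apply, hc, sqrtDiscFour]
        simp only [map_prod, map_sub]
        rfl
      have h2 := congrArg (fun a ↦ ((g a : Λ) : E)) h1
      simp only [AlgEquiv.commutes, map_prod, map_sub] at h2
      have h3 : ((algebraMap k Λ c : Λ) : E) = algebraMap k E c := rfl
      rw [h3, hc] at h2
      rw [h2, sqrtDiscFour]
      have h4 : ∀ z : Λ, ((z : Λ) : E) = Λ.val z := fun z ↦ rfl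
      simp only [h4, map_prod, map_sub]
      simp only [← h4, ← hπ]
      rfl
    refine ⟨⟨σ, ?_⟩, fun i ↦ (hπ i).symm⟩
    rw [Equiv.Perm.mem_alternatingGroup]
    rcases Int.units_eq_one_or (Equiv.Perm.sign σ) with h | h
    · exact h
    · rw [hVg, h] at hVσ
      exfalso
      apply mul_ne_zero h2 hV
      simp only [Units.val_neg, Units.val_one, Int.cast_neg, Int.cast_one] at hVσ
      linear_combination hVσ
  choose f hf using hperm
  have hfinj : Function.Injective f := by
    intro g g' h
    have hS : ∀ a ∈ Set.range y, ∀ ha : a ∈ Λ, g ⟨a, ha⟩ = g' ⟨a, ha⟩ := by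
      rintro _ ⟨i, rfl⟩ ha
      apply Subtype.val_injective
      change ((g ⟨y i, hmem i⟩ : Λ) : E) = ((g' ⟨y i, hmem i⟩ : Λ) : E)
      rw [hf, hf, h]
    have : (g : Λ →ₐ[k] Λ) = g' := by
      refine IntermediateField.algHom_ext_of_eq_adjoin k rfl ?_
      intro a ha
      exact hS a ha _
    ext a
    exact congrArg Subtype.val (DFunLike.congr_fun this a)
  rw [← IsGalois.card_aut_eq_finrank]
  calc Nat.card (Λ ≃ₐ[k] Λ) ≤ Nat.card (alternatingGroup (Fin 4)) :=
        Nat.card_le_card_of_injective f hfinj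
    _ = 12 := by rw [nat_card_alternatingGroup]; simp [Nat.factorial]

end GaloisGroup

/-! ### The degree of the splitting field -/

section AffineCoordinate

/-- The coordinate of the point `a` among the five points `∞, a, b, c, d`. -/
def coordAffine {K : Type*} [Field K] (a b c d : K) : K :=
  -25 * (sqDist b c + sqDist b d + sqDist c d) * ((b - a) * (c - a) * (d - a)) ^ 2 /
    hessAffine a b c d ^ 2

variable {K : Type*} [Field K]

lemma coordAffine_smul {l : K} (hl : l ≠ 0) (a b c d : K) :
    coordAffine (l * a) (l * b) (l * c) (l * d) = coordAffine a b c d := by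
  have h1 : hessAffine (l * a) (l * b) (l * c) (l * d) = l ^ 4 * hessAffine a b c d := by
    simp only [hessAffine, sqDist]; ring
  rw [coordAffine, coordAffine, h1, ← mul_div_mul_left _ (hessAffine a b c d ^ 2)
    (pow_ne_zero 8 hl)]
  simp only [sqDist]
  congr 1 <;> ring

lemma coordAffine_mem {k : Type*} [Field k] [Algebra k K] (S : IntermediateField k K)
    {a b c d : K} (ha : a ∈ S) (hb : b ∈ S) (hc : c ∈ S) (hd : d ∈ S) :
    coordAffine a b c d ∈ S := by
  lift a to S using ha
  lift b to S using hb
  lift c to S using hc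
  lift d to S using hd
  have : ((coordAffine a b c d : S) : K) = coordAffine (a : K) b c d := by
    have h25 : ((25 : S) : K) = 25 := map_ofNat S.val 25
    simp only [coordAffine, hessAffine, sqDist]
    push_cast [h25]
    rfl
  rw [← this]
  exact (coordAffine a b c d).2

lemma coordU_succ_aux {t T Q R A B H : K} (ht : t ≠ 0) (hT : T ≠ 0)
    (hQ : Q * t ^ 2 = T ^ 2 * A) (hR : R = t ^ 3 * T * B) :
    -25 * Q * R ^ 2 / (t ^ 2 * T ^ 2 * H) ^ 2 = -25 * A * B ^ 2 / H ^ 2 := by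
  have h : -25 * Q * R ^ 2 = t ^ 4 * T ^ 4 * (-25 * A * B ^ 2) := by
    rw [hR]
    linear_combination -25 * t ^ 4 * T ^ 2 * B ^ 2 * hQ
  rw [h, show (t ^ 2 * T ^ 2 * H) ^ 2 = t ^ 4 * T ^ 4 * H ^ 2 by ring,
    mul_div_mul_left _ _ (mul_ne_zero (pow_ne_zero _ ht) (pow_ne_zero _ hT))]

lemma IsChart.coordU_succ {x : Fin 5 → K} {t y : Fin 4 → K} (h : IsChart x t y)
    (ht : ∀ i, t i ≠ 0) :
    coordU x 1 = coordAffine (y 0) (y 1) (y 2) (y 3) ∧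
    coordU x 2 = coordAffine (y 1) (y 0) (y 2) (y 3) ∧
    coordU x 3 = coordAffine (y 2) (y 0) (y 1) (y 3) ∧
    coordU x 4 = coordAffine (y 3) (y 0) (y 1) (y 2) := by
  have hT : t 0 * t 1 * t 2 * t 3 ≠ 0 :=
    mul_ne_zero (mul_ne_zero (mul_ne_zero (ht 0) (ht 1)) (ht 2)) (ht 3)
  obtain ⟨h1, h2, h3, h4⟩ := h.hess_succ
  refine ⟨?_, ?_, ?_, ?_⟩
  · rw [coordU, h1, coordAffine]
    apply coordU_succ_aux (ht 0) hT
    · simp only [quart, quarticForm, fin_five_add, sqDist_sort x, h.sqDist_eq]; ring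
    · simp only [rootDeriv, fin_five_add, h.sub_eq]; ring
  · rw [coordU, h2, coordAffine]
    apply coordU_succ_aux (ht 1) hT
    · simp only [quart, quarticForm, fin_five_add, sqDist_sort x, h.sqDist_eq]; ring
    · simp only [rootDeriv, fin_five_add, h.sub_eq]; ring
  · rw [coordU, h3, coordAffine]
    apply coordU_succ_aux (ht 2) hT
    · simp only [quart, quarticForm, fin_five_add, sqDist_sort x, h.sqDist_eq]; ring
    · simp only [rootDeriv, fin_five_add, h.sub_eq]; ring
  · rw [coordU, h4, coordAffine]
    apply coordU_succ_aux (ht 3) hT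
    · simp only [quart, quarticForm, fin_five_add, h.sqDist_eq]; ring
    · simp only [rootDeriv, fin_five_add, h.sub_eq]; ring

end AffineCoordinate

section Elimination

variable {k E : Type*} [Field k] [Field E] [Algebra k E]

/-- An element of degree `5` is not a root of a nonzero polynomial of degree `3`. -/
lemma leadingCoeff_eq_zero_of_cubic {ρ : E} (hρ : (minpoly k ρ).natDegree = 5)
    {a b c d : k} (h : algebraMap k E a * ρ ^ 3 + algebraMap k E b * ρ ^ 2 +
      algebraMap k E c * ρ + algebraMap k E d = 0) : a = 0 := by
  by_contra ha
  have hP : (C a * X ^ 3 + C b * X ^ 2 + C c * X + C d : k[X]).natDegree = 3 :=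
    natDegree_cubic ha
  have hdvd : minpoly k ρ ∣ (C a * X ^ 3 + C b * X ^ 2 + C c * X + C d : k[X]) := by
    apply minpoly.dvd
    simpa using h
  have := natDegree_le_of_dvd hdvd (fun h0 ↦ by simp [h0] at hP)
  omega

/-- The parameter `v` is a rational function of `ρ` and of the two invariants
`δ = 100 D ^ 2 / A ^ 2` and `q = A ^ 3 / (64 M)`: it satisfies a quadratic and a cubic equation,
and the elimination of the higher powers leaves a linear one, which is nontrivial because `ρ` has
degree `5`. -/
lemma mem_adjoin_of_shape {ρ v : E} (hρ : (minpoly k ρ).natDegree = 5) {δ q : k}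
    (h2 : (2 : k) ≠ 0) (h3 : (3 : k) ≠ 0) (h5 : (5 : k) ≠ 0) (hδ : 3 * δ + 25 ≠ 0)
    (hA : algebraMap k E δ * (6 + 9 * v + 40 * ρ) ^ 2 = 25 * discShape v ρ)
    (hM : 64 * algebraMap k E q * hessShape v ρ = (6 + 9 * v + 40 * ρ) ^ 3) :
    v ≠ 0 ∧ v ∈ IntermediateField.adjoin k {ρ} := by
  constructor
  · rintro rfl
    have : (-6400 : k) = 0 := by
      apply leadingCoeff_eq_zero_of_cubic hρ (b := 1600 * δ + 3200) (c := 480 * δ - 400)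
        (d := 36 * δ)
      simp only [map_neg, map_add, map_sub, map_mul, map_ofNat]
      rw [discShape] at hA
      linear_combination hA
    rw [neg_eq_zero, show (6400 : k) = 2 ^ 8 * 5 ^ 2 by norm_num] at this
    exact mul_ne_zero (pow_ne_zero _ h2) (pow_ne_zero _ h5) this
  · set S := IntermediateField.adjoin k {ρ}
    -- the coefficients of the quadratic equation `c2 v² + c1 v + c0 = 0`, expanded in `ρ`
    let c2 : k := 81 * δ + 675
    let c10 : k := 108 * δ + 100
    let c11 : k := 720 * δ - 3600
    let c00 : k := 36 * δ
    let c01 : k := 480 * δ - 400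
    let c02 : k := 1600 * δ + 3200
    -- the coefficients of the cubic equation `729 v³ + e2 v² + e1 v + e0 = 0`, expanded in `ρ`
    let e20 : k := 1458 - 331776 * q
    let e21 : k := 9720 - 3538944 * q
    let e10 : k := 972 - 297984 * q
    let e11 : k := 12960 - 4726784 * q
    let e12 : k := 43200 - 16957440 * q
    let f : k →+* E := algebraMap k E
    let l : E := f (-729 * c2 * -6400) * ρ ^ 3 +
      f (c2 ^ 2 * e12 - 729 * c2 * c02 - (e21 * c2 - 729 * c11) * c11) * ρ ^ 2 +
      f (c2 ^ 2 * e11 - 729 * c2 * c01 - (e20 * c2 - 729 * c10) * c11 -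
        (e21 * c2 - 729 * c11) * c10) * ρ +
      f (c2 ^ 2 * e10 - 729 * c2 * c00 - (e20 * c2 - 729 * c10) * c10)
    let C0 : E := f c00 + f c01 * ρ + f c02 * ρ ^ 2 + f (-6400) * ρ ^ 3
    let C1 : E := f c10 + f c11 * ρ
    let E0 : E := (f 6 + f 40 * ρ) ^ 3 + f (-64 * q) * (f 160000 * ρ ^ 4 + f 275200 * ρ ^ 3 +
      f 144736 * ρ ^ 2 + f 22704 * ρ + f 1089)
    let E2 : E := f e20 + f e21 * ρ
    have hc2 : c2 ≠ 0 := by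
      have : c2 = 3 ^ 3 * (3 * δ + 25) := by simp only [c2]; ring
      rw [this]
      exact mul_ne_zero (pow_ne_zero _ h3) hδ
    have hl : l ≠ 0 := by
      intro h
      have h0 := leadingCoeff_eq_zero_of_cubic hρ h
      rw [show -729 * c2 * -6400 = 2 ^ 8 * 3 ^ 6 * 5 ^ 2 * c2 by ring] at h0
      exact mul_ne_zero (mul_ne_zero (mul_ne_zero (pow_ne_zero _ h2) (pow_ne_zero _ h3))
        (pow_ne_zero _ h5)) hc2 h0
    have hlin : l * v = (E2 * f c2 + f (-729) * C1) * C0 - f c2 ^ 2 * E0 := by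
      rw [discShape] at hA
      rw [hessShape] at hM
      simp only [l, C0, C1, E0, E2, c2, c10, c11, c00, c01, c02, e20, e21, e10, e11, e12,
        map_neg, map_add, map_sub, map_mul, map_pow, map_ofNat]
      change f δ * _ = _ at hA
      change 64 * f q * _ = _ at hM
      generalize f δ = d at hA ⊢
      generalize f q = r at hM ⊢
      linear_combination -(81 * d + 675) ^ 2 * hM - (729 * (81 * d + 675) * v +
        ((1458 - 331776 * r + (9720 - 3538944 * r) * ρ) * (81 * d + 675) -
          729 * (108 * d + 100 + (720 * d - 3600) * ρ))) * hA
    have hρS : ρ ∈ S := IntermediateField.mem_adjoin_simple_self k ρ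
    have hf : ∀ c : k, f c ∈ S := fun c ↦ S.algebraMap_mem c
    have hm : ∀ (c : k) (n : ℕ), f c * ρ ^ n ∈ S := fun c n ↦
      S.mul_mem (hf c) (pow_mem hρS n)
    have hm1 : ∀ c : k, f c * ρ ∈ S := fun c ↦ S.mul_mem (hf c) hρS
    have hlS : l ∈ S := S.add_mem (S.add_mem (S.add_mem (hm _ 3) (hm _ 2)) (hm1 _)) (hf _)
    have hC0 : C0 ∈ S := S.add_mem (S.add_mem (S.add_mem (hf _) (hm1 _)) (hm _ 2)) (hm _ 3)
    have hC1 : C1 ∈ S := S.add_mem (hf _) (hm1 _)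
    have hE2 : E2 ∈ S := S.add_mem (hf _) (hm1 _)
    have hE0 : E0 ∈ S := S.add_mem (pow_mem (S.add_mem (hf _) (hm1 _)) 3)
      (S.mul_mem (hf _) (S.add_mem (S.add_mem (S.add_mem (S.add_mem (hm _ 4) (hm _ 3)) (hm _ 2))
        (hm1 _)) (hf _)))
    rw [eq_div_of_mul_eq hl ((mul_comm v l).trans hlin)]
    exact S.div_mem (S.sub_mem (S.mul_mem (S.add_mem (S.mul_mem hE2 (hf _))
      (S.mul_mem (hf _) hC1)) hC0) (S.mul_mem (pow_mem (hf _) 2) hE0)) hlS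

end Elimination

section Tower

variable {k E : Type*} [Field k] [Field E] [Algebra k E]

lemma sqrtDiscFour_smul (l : E) (y : Fin 4 → E) :
    sqrtDiscFour (fun i ↦ l * y i) = l ^ 6 * sqrtDiscFour y := by
  simp only [sqrtDiscFour_eq]; ring

lemma eval_depressed {y : Fin 4 → E} (h0 : y 0 + y 1 + y 2 + y 3 = 0) (i : Fin 4) :
    y i ^ 4 + (y 0 * y 1 + y 0 * y 2 + y 0 * y 3 + y 1 * y 2 + y 1 * y 3 + y 2 * y 3) * y i ^ 2 +
      -(y 0 * y 1 * y 2 + y 0 * y 1 * y 3 + y 0 * y 2 * y 3 + y 1 * y 2 * y 3) * y i +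
      y 0 * y 1 * y 2 * y 3 = 0 := by
  have h3 : y 3 = -(y 0 + y 1 + y 2) := by linear_combination h0
  fin_cases i <;> simp only [Fin.zero_eta, Fin.mk_one, Fin.reduceFinMk, h3] <;> ring

/-- The coordinates of five points generate an extension of degree at most `60` of a field that
contains `D / A` and `A ^ 3 / M`: the extension generated by the first coordinate has degree `5`,
and over it the other four points are, after a change of chart, the roots of a quartic whose
discriminant is a square. -/
lemma finrank_adjoin_coordU_le {s : alternatingGroup (Fin 5) →* (E ≃ₐ[k] E)} {x : Fin 5 → E}
    (hs : IsEquivariant s x) (hA : pentagonSum x ≠ 0) (hD : sqrtDisc x ≠ 0)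
    (hM : hessProd x ≠ 0) (hAD : pentagonSum x ^ 2 + 12 * sqrtDisc x ^ 2 ≠ 0)
    (h01 : coordU x 0 ≠ coordU x 1) (h2 : (2 : k) ≠ 0) (h3 : (3 : k) ≠ 0) (h5 : (5 : k) ≠ 0)
    {d q : k} (hd : algebraMap k E d = 10 * sqrtDisc x / pentagonSum x)
    (hq : algebraMap k E q = pentagonSum x ^ 3 / (64 * hessProd x)) :
    FiniteDimensional k (IntermediateField.adjoin k (Set.range (coordU x))) ∧
      Module.finrank k (IntermediateField.adjoin k (Set.range (coordU x))) ≤ 60 := by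
  have hx := injective_of_sqrtDisc_ne_zero hD
  have h2' : (2 : E) ≠ 0 := algebraMap_ofNat_ne_zero h2
  have h3' : (3 : E) ≠ 0 := algebraMap_ofNat_ne_zero h3
  have h5' : (5 : E) ≠ 0 := algebraMap_ofNat_ne_zero h5
  -- the first coordinate has degree `5`
  have hP : ∀ i, aeval (coordU x i) (secondPolynomial (d ^ 2) q) = 0 := by
    intro i
    rw [← eval_map_algebraMap, map_secondPolynomial, map_pow, hd, hq]
    exact eval_secondPolynomial hx hM h2' h3' hA i
  obtain ⟨-, -, hint, hdeg⟩ := minpoly_natDegree_of_isEquivariant hs.coordU h01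
    (natDegree_secondPolynomial _ _) hP
  obtain ⟨t, y, hc, h0, ht⟩ := exists_isChart hx h2'
  have hroot := eval_depressed h0
  obtain ⟨pp, hpp⟩ : ∃ pp, pp = y 0 * y 1 + y 0 * y 2 + y 0 * y 3 + y 1 * y 2 + y 1 * y 3 +
    y 2 * y 3 := ⟨_, rfl⟩
  obtain ⟨qq, hqq⟩ : ∃ qq, qq = -(y 0 * y 1 * y 2 + y 0 * y 1 * y 3 + y 0 * y 2 * y 3 +
    y 1 * y 2 * y 3) := ⟨_, rfl⟩
  obtain ⟨rr, hrr⟩ : ∃ rr, rr = y 0 * y 1 * y 2 * y 3 := ⟨_, rfl⟩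
  rw [← hpp, ← hqq, ← hrr] at hroot
  have hp0 : pp ≠ 0 := by
    intro hp
    have h := hess_ne_zero hM 0
    rw [hc.hess_zero, sqDistSum_eq h0 hpp, hp] at h
    simp at h
  have hsh := hc.hasShape h0 ht h2' hp0 hpp hqq hrr
  obtain ⟨v, hv⟩ : ∃ v, v = qq ^ 2 / pp ^ 3 := ⟨_, rfl⟩
  obtain ⟨ρ, hρ⟩ : ∃ ρ, ρ = rr / pp ^ 2 := ⟨_, rfl⟩
  obtain ⟨T, hT⟩ : ∃ T, T = t 0 * t 1 * t 2 * t 3 := ⟨_, rfl⟩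
  have hT0 : T ≠ 0 := by
    rw [hT]; exact mul_ne_zero (mul_ne_zero (mul_ne_zero (ht 0) (ht 1)) (ht 2)) (ht 3)
  rw [← hv, ← hρ, ← hT] at hsh
  have hDV := hc.sqrtDisc_eq
  rw [← hT] at hDV
  obtain ⟨a, ha⟩ : ∃ a, a = 6 + 9 * v + 40 * ρ := ⟨_, rfl⟩
  have hAs := hsh.pentagonSum_eq
  have hDs := hsh.sqrtDisc_sq
  have hMs := hsh.hessProd_eq
  have hs0 := hsh.s_ne_zero
  have hUs := hsh.coordU_zero
  rw [← ha] at hAs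
  have ha0 : a ≠ 0 := by
    rintro h
    rw [h, mul_zero] at hAs
    exact hA hAs
  have hh0 : hessShape v ρ ≠ 0 := by
    rintro h
    rw [h, mul_zero] at hMs
    exact hM hMs
  -- the field generated by the first coordinate is generated by `ρ`
  have hk1 : IntermediateField.adjoin k {ρ} = IntermediateField.adjoin k {coordU x 0} := by
    have h32 : (32 : E) ≠ 0 := by
      rw [show (32 : E) = 2 ^ 5 by norm_num]; exact pow_ne_zero _ h2'
    apply le_antisymm
    · rw [IntermediateField.adjoin_simple_le_iff]
      have : ρ = (coordU x 0 * algebraMap k E (-32 / 25) - algebraMap k E 1) *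
          algebraMap k E (1 / 12) := by
        simp only [map_div₀, map_neg, map_ofNat, map_one]
        have h25 : (25 : E) ≠ 0 := by
          rw [show (25 : E) = 5 ^ 2 by norm_num]; exact pow_ne_zero _ h5'
        have h12 : (12 : E) ≠ 0 := by
          rw [show (12 : E) = 2 ^ 2 * 3 by norm_num]; exact mul_ne_zero (pow_ne_zero _ h2') h3'
        rw [hUs]
        field_simp
        ring
      rw [this]
      exact mul_mem (sub_mem (mul_mem (IntermediateField.mem_adjoin_simple_self k _)
        (IntermediateField.algebraMap_mem _ _)) (IntermediateField.algebraMap_mem _ _))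
        (IntermediateField.algebraMap_mem _ _)
    · rw [IntermediateField.adjoin_simple_le_iff, hUs]
      have : -25 * (12 * ρ + 1) / 32 = (ρ * algebraMap k E 12 + algebraMap k E 1) *
          algebraMap k E (-25 / 32) := by
        simp only [map_div₀, map_neg, map_ofNat, map_one]
        ring
      rw [this]
      exact mul_mem (add_mem (mul_mem (IntermediateField.mem_adjoin_simple_self k _)
        (IntermediateField.algebraMap_mem _ _)) (IntermediateField.algebraMap_mem _ _))
        (IntermediateField.algebraMap_mem _ _)
  have hrank : Module.finrank k (IntermediateField.adjoin k {ρ}) = 5 := by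
    rw [hk1, IntermediateField.adjoin.finrank hint, hdeg]
  have hdegρ : (minpoly k ρ).natDegree = 5 := by
    rw [← IntermediateField.adjoin.finrank, hrank]
    by_contra h
    have : IsIntegral k ρ := by
      have hmem : ρ ∈ IntermediateField.adjoin k {coordU x 0} := hk1 ▸
        IntermediateField.mem_adjoin_simple_self k ρ
      have := IntermediateField.adjoin.finiteDimensional hint
      exact (IntermediateField.isIntegral_iff (x := (⟨ρ, hmem⟩ :
        IntermediateField.adjoin k {coordU x 0}))).mp (IsIntegral.of_finite k _)
    exact h this
  have hδ : 3 * d ^ 2 + 25 ≠ 0 := by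
    intro h
    have h' := congrArg (algebraMap k E) h
    simp only [map_add, map_mul, map_pow, map_ofNat, map_zero, hd] at h'
    apply mul_ne_zero (pow_ne_zero 2 h5') hAD
    field_simp at h'
    linear_combination h'
  obtain ⟨hv0, hvk⟩ := mem_adjoin_of_shape hdegρ (v := v) (δ := d ^ 2) (q := q) h2 h3 h5 hδ
    (by
      rw [map_pow, hd, div_pow, mul_pow, hDs, hAs, ← ha]
      field_simp
      ring)
    (by
      rw [hq, hMs, hAs, ← ha]
      have h8 : (8 : E) ≠ 0 := by
        rw [show (8 : E) = 2 ^ 3 by norm_num]; exact pow_ne_zero _ h2'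
      have h64 : (64 : E) ≠ 0 := by
        rw [show (64 : E) = 2 ^ 6 by norm_num]; exact pow_ne_zero _ h2'
      field_simp
      ring)
  have hqq0 : qq ≠ 0 := by
    rintro rfl
    apply hv0
    rw [hv]; simp
  obtain ⟨k1, hk1def⟩ : ∃ k1, k1 = IntermediateField.adjoin k {ρ} := ⟨_, rfl⟩
  rw [← hk1def] at hrank hvk
  have hρk : ρ ∈ k1 := hk1def ▸ IntermediateField.mem_adjoin_simple_self k ρ
  have hfin : FiniteDimensional k k1 := Module.finite_of_finrank_pos (by omega)
  -- the four other points, in a chart in which their quartic is defined over `k1`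
  let w : Fin 4 → E := fun i ↦ pp / qq * y i
  let vk : k1 := ⟨v, hvk⟩
  let rk : k1 := ⟨ρ, hρk⟩
  have hvk' : algebraMap k1 E vk = v := rfl
  have hrk' : algebraMap k1 E rk = ρ := rfl
  let Q : k1[X] := X ^ 4 + C (1 / vk) * X ^ 2 + C (1 / vk) * X + C (rk / vk ^ 2)
  have hQ : Q.natDegree = 4 := by simp only [Q]; compute_degree!
  have hQroot : ∀ i, aeval (w i) Q = 0 := by
    intro i
    simp only [Q, map_add, map_mul, map_pow, aeval_X, aeval_C, map_div₀, map_one, hvk', hrk', w]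
    rw [hv, hρ]
    field_simp
    linear_combination pp ^ 4 * hroot i
  have hV : sqrtDiscFour y ≠ 0 := by
    intro h
    rw [h, mul_zero] at hDV
    exact hD hDV
  have hw : Function.Injective w := by
    rw [← Matrix.det_vandermonde_ne_zero_iff, Matrix.det_vandermonde]
    change sqrtDiscFour w ≠ 0
    rw [sqrtDiscFour_smul]
    exact mul_ne_zero (pow_ne_zero _ (div_ne_zero hp0 hqq0)) hV
  have hck : algebraMap k1 E (-(algebraMap k k1 d * (6 + 9 * vk + 40 * rk)) / (5 * vk ^ 3)) =
      sqrtDiscFour w := by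
    rw [sqrtDiscFour_smul]
    simp only [map_add, map_mul, map_pow, map_div₀, map_neg, map_ofNat, hvk', hrk']
    rw [← IsScalarTower.algebraMap_apply, hd, ← ha, hAs, hDV, hv]
    field_simp
    ring
  obtain ⟨hfin', hrank'⟩ := finrank_adjoin_le_twelve hw h2' hQ hQroot hck
  obtain ⟨Λ, hΛ⟩ : ∃ Λ, Λ = IntermediateField.adjoin k1 (Set.range w) := ⟨_, rfl⟩
  rw [← hΛ] at hfin' hrank'
  have hwΛ : ∀ i, w i ∈ Λ := fun i ↦ hΛ ▸ IntermediateField.subset_adjoin k1 _ ⟨i, rfl⟩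
  have hle : IntermediateField.adjoin k (Set.range (coordU x)) ≤ Λ.restrictScalars k := by
    rw [IntermediateField.adjoin_le_iff]
    obtain ⟨hu1, hu2, hu3, hu4⟩ := hc.coordU_succ ht
    have hl := div_ne_zero hp0 hqq0
    have hmem : ∀ a b c d : Fin 4, coordAffine (y a) (y b) (y c) (y d) ∈ Λ := by
      intro a b c d
      rw [← coordAffine_smul hl]
      exact coordAffine_mem Λ (hwΛ a) (hwΛ b) (hwΛ c) (hwΛ d)
    rintro _ ⟨i, rfl⟩
    rw [SetLike.mem_coe, IntermediateField.mem_restrictScalars]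
    fin_cases i
    · have : coordU x 0 ∈ k1 := by
        rw [hk1def, hk1]; exact IntermediateField.mem_adjoin_simple_self k _
      exact Λ.algebraMap_mem ⟨coordU x 0, this⟩
    · exact hu1 ▸ hmem _ _ _ _
    · exact hu2 ▸ hmem _ _ _ _
    · exact hu3 ▸ hmem _ _ _ _
    · exact hu4 ▸ hmem _ _ _ _
  have hfinΛ : FiniteDimensional k (Λ.restrictScalars k) := Module.Finite.trans (R := k) k1 Λ
  have hfree : Module.Free k1 Λ := Module.Free.of_divisionRing k1 Λ
  have hrankΛ : Module.finrank k (Λ.restrictScalars k) = 5 * Module.finrank k1 Λ := by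
    rw [← hrank]
    exact (Module.finrank_mul_finrank k k1 Λ).symm
  refine ⟨?_, ?_⟩
  · exact FiniteDimensional.of_injective (IntermediateField.inclusion hle).toLinearMap
      (IntermediateField.inclusion hle).injective
  · have := LinearMap.finrank_le_finrank_of_injective
      (f := (IntermediateField.inclusion hle).toLinearMap)
      (IntermediateField.inclusion hle).injective
    omega

end Tower

/-! ### Algebraic independence of the invariants -/

section Independence

/-- If `π` kills `d ≠ 0` and maps the family `v` to an algebraically independent one, then `v`
remains algebraically independent when `d` is added: the constant coefficient of an algebraic
equation for `d` over `F[v]` would be killed by `π`. -/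
lemma AlgebraicIndependent.vecCons {F B B' : Type*} [Field F] [CommRing B] [IsDomain B]
    [CommRing B'] [Algebra F B] [Algebra F B'] (π : B →ₐ[F] B') {n : ℕ} {v : Fin n → B} {d : B}
    (hd : d ≠ 0) (hπ : π d = 0) (hv : AlgebraicIndependent F (π ∘ v)) :
    AlgebraicIndependent F (Matrix.vecCons d v) := by
  have hv' : AlgebraicIndependent F v := hv.of_comp π
  have htr : Transcendental (Algebra.adjoin F (Set.range v)) d := by
    intro halg
    obtain ⟨q, hq0, hq⟩ :=
      halg.exists_nonzero_coeff_and_aeval_eq_zero (mem_nonZeroDivisors_of_ne_zero hd)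
    have hπq : π (q.coeff 0 : B) = 0 := by
      obtain ⟨r, hr⟩ := X_dvd_sub_C (p := q)
      have h := congrArg (fun s ↦ π (aeval d s)) hr
      simp only [map_sub, map_mul, aeval_X, aeval_C, hq, hπ, zero_mul, map_zero] at h
      have h' : π (algebraMap (Algebra.adjoin F (Set.range v)) B (q.coeff 0)) = 0 := by
        linear_combination -h
      exact h'
    obtain ⟨g, hg⟩ := (Algebra.adjoin_range_eq_range_aeval F v).le (q.coeff 0).2
    change MvPolynomial.aeval v g = _ at hg
    rw [← hg, ← AlgHom.comp_apply, MvPolynomial.comp_aeval] at hπq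
    have hg0 : g = 0 := hv.eq_zero_of_aeval_eq_zero g hπq
    exact hq0 (Subtype.ext (by rw [← hg, hg0]; simp))
  have h := ((hv'.option_iff_transcendental d).mpr htr).comp _ (finSuccEquiv n).injective
  convert h using 1
  funext i
  cases i using Fin.cases <;> simp

/-- A family of `n` elements that generates a field containing `n` algebraically independent
elements is algebraically independent. -/
lemma AlgebraicIndependent.of_mem_adjoin {F E : Type*} [Field F] [Field E] [Algebra F E] {n : ℕ}
    {v w : Fin n → E} (hv : AlgebraicIndependent F v)
    (h : ∀ i, v i ∈ IntermediateField.adjoin F (Set.range w)) : AlgebraicIndependent F w := by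
  let k := IntermediateField.adjoin F (Set.range w)
  have hmemw : ∀ i, w i ∈ k := fun i ↦ IntermediateField.subset_adjoin F _ ⟨i, rfl⟩
  let w' : Fin n → k := fun i ↦ ⟨w i, hmemw i⟩
  let v' : Fin n → k := fun i ↦ ⟨v i, h i⟩
  have hv' : AlgebraicIndependent F v' := AlgebraicIndependent.of_comp k.val hv
  have : Algebra.IsAlgebraic (Algebra.adjoin F (Set.range w')) k := by
    refine ⟨fun z ↦ ?_⟩
    obtain ⟨r, s, hrs⟩ := (IntermediateField.mem_adjoin_range_iff F w z).mp z.2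
    have hz : z = MvPolynomial.aeval w' r / MvPolynomial.aeval w' s := by
      have hval : ∀ f : MvPolynomial (Fin n) F,
          k.val (MvPolynomial.aeval w' f) = MvPolynomial.aeval w f := by
        intro f
        rw [← AlgHom.comp_apply, MvPolynomial.comp_aeval]
        rfl
      apply Subtype.val_injective
      rw [hrs, ← hval, ← hval, ← map_div₀, IntermediateField.coe_val]
    have hmem : ∀ f : MvPolynomial (Fin n) F,
        IsAlgebraic (Algebra.adjoin F (Set.range w')) (MvPolynomial.aeval w' f) := by
      intro f
      have hf : MvPolynomial.aeval w' f ∈ Algebra.adjoin F (Set.range w') := by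
        rw [Algebra.adjoin_range_eq_range_aeval]; exact ⟨f, rfl⟩
      exact isAlgebraic_algebraMap (⟨_, hf⟩ : Algebra.adjoin F (Set.range w'))
    rw [hz, div_eq_mul_inv]
    exact (hmem r).mul (hmem s).inv
  have hw : AlgebraicIndependent F w' :=
    (Algebra.IsAlgebraic.isTranscendenceBasis_of_lift_le_trdeg_of_finite F w'
      hv'.lift_cardinalMk_le_trdeg).1
  exact hw.map' (f := k.val) k.val.injective

variable (F : Type*) [Field F]

/-- The discriminant root `D`, the form `16 M - 81 A ^ 3`, which vanishes on configurations with two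
double points, and `A` itself are separated by letting points collide one after the other. -/
lemma algebraicIndependent_invariants (h2 : (2 : F) ≠ 0) (h3 : (3 : F) ≠ 0)
    {x : Fin 5 → MvPolynomial (Fin 5) F} (hx : x = MvPolynomial.X) :
    AlgebraicIndependent F ![sqrtDisc x, 16 * hessProd x - 81 * pentagonSum x ^ 3,
      pentagonSum x] := by
  -- the first two points collide
  let y : Fin 5 → MvPolynomial (Fin 2) F := ![0, 0, .X 0, .X 0 + .X 1, 2 * .X 0]
  let π₁ : MvPolynomial (Fin 5) F →ₐ[F] MvPolynomial (Fin 2) F := MvPolynomial.aeval y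
  have hπ₁ : (fun i ↦ π₁ (x i)) = y := by funext i; simp [π₁, hx]
  -- two further points collide
  let z : Fin 5 → F[X] := ![0, 0, X, X, 2 * X]
  let π₂ : MvPolynomial (Fin 2) F →ₐ[F] F[X] := MvPolynomial.aeval ![X, 0]
  have hπ₂ : (fun i ↦ π₂ (y i)) = z := by
    funext i
    fin_cases i <;> simp [π₂, y, z]
  let π₃ : F[X] →ₐ[F] F := aeval 0
  have hA : pentagonSum z = 16 * X ^ 10 := by
    simp only [pentagonSum, sqDist, z, Matrix.cons_val]; ring
  have hD₁ : sqrtDisc y = 0 := by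
    simp [sqrtDisc_eq, y]
  have hN₁ : 16 * hessProd y - 81 * pentagonSum y ^ 3 ≠ 0 := by
    intro h
    -- at the points `0, 0, 1, -1, 2` the form takes the value `-2 ^ 14 * 3 ^ 4`
    have := congrArg (MvPolynomial.aeval (![1, -2] : Fin 2 → F)) h
    simp only [map_sub, map_mul, map_pow, map_ofNat, map_pentagonSum, map_hessProd, map_zero]
      at this
    apply two_pow_mul_three_pow_ne_zero h2 h3 14 4
    rw [← neg_eq_zero, ← this]
    simp only [pentagonSum, hessProd, Fin.prod_univ_five, hess, hessForm, fin_five_add, sqDist, y,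
      Matrix.cons_val, map_zero, map_add, map_mul, map_ofNat, MvPolynomial.aeval_X]
    norm_num
  have hN₂ : 16 * hessProd z - 81 * pentagonSum z ^ 3 = 0 := by
    rw [hA]
    simp only [hessProd, Fin.prod_univ_five, hess, hessForm, fin_five_add, sqDist, z,
      Matrix.cons_val]
    ring
  have hD₀ : sqrtDisc x ≠ 0 := hx ▸ sqrtDisc_X_ne_zero F h2 h3
  refine AlgebraicIndependent.vecCons π₁ hD₀ ?_ ?_
  · rw [map_sqrtDisc, hπ₁, hD₁]
  have h1 : π₁ ∘ ![16 * hessProd x - 81 * pentagonSum x ^ 3, pentagonSum x] =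
      ![16 * hessProd y - 81 * pentagonSum y ^ 3, pentagonSum y] := by
    funext i
    fin_cases i <;> simp [map_pentagonSum, map_hessProd, hπ₁, map_ofNat π₁]
  rw [h1]
  refine AlgebraicIndependent.vecCons π₂ hN₁ ?_ ?_
  · simp only [map_sub, map_mul, map_pow, map_ofNat, map_pentagonSum, map_hessProd, hπ₂, hN₂]
  have h1' : π₂ ∘ ![pentagonSum y] = ![pentagonSum z] := by
    funext i
    fin_cases i
    simp [map_pentagonSum, hπ₂]
  rw [h1', hA]
  refine AlgebraicIndependent.vecCons π₃ ?_ ?_ ?_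
  · have h16 : (16 : F[X]) = C 16 := (map_ofNat C 16).symm
    rw [h16]
    refine mul_ne_zero ?_ (pow_ne_zero _ X_ne_zero)
    rw [ne_eq, C_eq_zero, show (16 : F) = 2 ^ 4 by norm_num]
    exact pow_ne_zero _ h2
  · simp [π₃]
  · exact algebraicIndependent_empty_type

end Independence

/-! ### The Galois groups over the fields of rational functions -/

section Generic

/-- The five indeterminates, as points over the field of rational functions that they generate. -/
noncomputable def indetPoints (F : Type) [Field F] : Fin 5 → RatFunField F 5 :=
  fun i ↦ indet F i

lemma algebraMap_ratFunField_ne_zero {F : Type} [Field F] {f : MvPolynomial (Fin 5) F} (h : f ≠ 0) :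
    algebraMap (MvPolynomial (Fin 5) F) (RatFunField F 5) f ≠ 0 :=
  (map_ne_zero_iff _ (IsFractionRing.injective _ _)).mpr h

/-- The alternating group permutes the indeterminates. -/
noncomputable def permuteIndets (F : Type) [Field F] :
    alternatingGroup (Fin 5) →* (RatFunField F 5 ≃ₐ[F] RatFunField F 5) where
  toFun g := IsFractionRing.fieldEquivOfAlgEquiv F (RatFunField F 5) (RatFunField F 5)
    (MvPolynomial.renameEquiv F (g : Equiv.Perm (Fin 5)))
  map_one' := by
    rw [OneMemClass.coe_one, Equiv.Perm.one_def, MvPolynomial.renameEquiv_refl]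
    exact IsFractionRing.fieldEquivOfAlgEquiv_refl F _ F _
  map_mul' g h := by
    rw [Subgroup.coe_mul, Equiv.Perm.mul_def, ← MvPolynomial.renameEquiv_trans]
    exact IsFractionRing.fieldEquivOfAlgEquiv_trans F _ _ _ _ _

lemma permuteIndets_apply {F : Type} [Field F] (g : alternatingGroup (Fin 5)) (i : Fin 5) :
    permuteIndets F g (indetPoints F i) = indetPoints F ((g : Equiv.Perm (Fin 5)) i) := by
  simp [permuteIndets, indetPoints, indet]

variable {F : Type} [Field F]

lemma permuteIndets_pentagonSum (g : alternatingGroup (Fin 5)) :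
    permuteIndets F g (pentagonSum (indetPoints F)) = pentagonSum (indetPoints F) := by
  simp only [map_pentagonSum, permuteIndets_apply, pentagonSum_comp]

lemma permuteIndets_sqrtDisc (g : alternatingGroup (Fin 5)) :
    permuteIndets F g (sqrtDisc (indetPoints F)) = sqrtDisc (indetPoints F) := by
  have hg : Equiv.Perm.sign (g : Equiv.Perm (Fin 5)) = 1 := g.2
  simp only [map_sqrtDisc, permuteIndets_apply, sqrtDisc_comp, hg, Units.val_one, Int.cast_one,
    one_mul]

lemma permuteIndets_hessProd (g : alternatingGroup (Fin 5)) :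
    permuteIndets F g (hessProd (indetPoints F)) = hessProd (indetPoints F) := by
  simp only [map_hessProd, permuteIndets_apply, hessProd_comp]

/-- Algebraically independent elements that are fixed by `A₅` identify the field of rational
functions in `m` indeterminates with a subfield over which `A₅` acts. -/
lemma exists_isEquivariant_of_fixed {m : ℕ} {v : Fin m → RatFunField F 5}
    (hv : AlgebraicIndependent F v) (hfix : ∀ g i, permuteIndets F g (v i) = v i) :
    ∃ (_ : Algebra (RatFunField F m) (RatFunField F 5)) (s : alternatingGroup (Fin 5) →*
      (RatFunField F 5 ≃ₐ[RatFunField F m] RatFunField F 5)),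
      IsEquivariant s (indetPoints F) ∧
      ∀ i, algebraMap (RatFunField F m) (RatFunField F 5) (indet F i) = v i := by
  have hinj : Function.Injective (MvPolynomial.aeval v : MvPolynomial (Fin m) F →ₐ[F] _) := hv
  let φ : RatFunField F m →ₐ[F] RatFunField F 5 := IsFractionRing.liftAlgHom hinj
  have hφ : ∀ f, φ (algebraMap (MvPolynomial (Fin m) F) _ f) = MvPolynomial.aeval v f := fun f ↦
    IsFractionRing.lift_algebraMap hinj f
  have hcomm : ∀ g c, permuteIndets F g (φ c) = φ c := by
    intro g c
    obtain ⟨a, b, -, rfl⟩ := IsFractionRing.div_surjective (MvPolynomial (Fin m) F) c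
    have hg : ∀ f : MvPolynomial (Fin m) F,
        permuteIndets F g (MvPolynomial.aeval v f) = MvPolynomial.aeval v f := by
      intro f
      rw [← AlgEquiv.coe_toAlgHom, ← AlgHom.comp_apply, MvPolynomial.comp_aeval]
      congr 2
      funext i
      exact hfix g i
    rw [map_div₀, map_div₀, hφ, hφ, hg, hg]
  let _ : Algebra (RatFunField F m) (RatFunField F 5) := φ.toRingHom.toAlgebra
  refine ⟨inferInstance, ⟨⟨fun g ↦ AlgEquiv.ofRingEquiv (f := (permuteIndets F g).toRingEquiv)
    (hcomm g), ?_⟩, ?_⟩, permuteIndets_apply, fun i ↦ ?_⟩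
  · ext c; exact DFunLike.congr_fun (map_one (permuteIndets F)) c
  · intro g h
    ext c; exact DFunLike.congr_fun (map_mul (permuteIndets F) g h) c
  · exact (hφ _).trans (MvPolynomial.aeval_X v i)

lemma algebraicIndependent_indetPoints (h2 : (2 : F) ≠ 0) (h3 : (3 : F) ≠ 0) :
    AlgebraicIndependent F ![sqrtDisc (indetPoints F),
      16 * hessProd (indetPoints F) - 81 * pentagonSum (indetPoints F) ^ 3,
      pentagonSum (indetPoints F)] := by
  have h := (algebraicIndependent_invariants F h2 h3 rfl).map'
    (f := IsScalarTower.toAlgHom F (MvPolynomial (Fin 5) F) (RatFunField F 5))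
    (IsFractionRing.injective _ _)
  convert h using 1
  funext i
  fin_cases i <;>
    simp only [Function.comp_apply, IsScalarTower.coe_toAlgHom', Fin.zero_eta, Fin.mk_one,
      Fin.reduceFinMk, Matrix.cons_val, map_sub, map_mul, map_pow, map_ofNat, map_sqrtDisc,
      map_pentagonSum, map_hessProd] <;> rfl

end Generic

section Parameters

variable {F E : Type*} [Field F] [Field E] [Algebra F E] {A D M : E}
  (h : AlgebraicIndependent F ![D, 16 * M - 81 * A ^ 3, A])
include h

lemma algebraicIndependent_firstParameters (h2 : (2 : E) ≠ 0) :
    AlgebraicIndependent F ![A, 2 * D, 8 * M] := by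
  refine h.of_mem_adjoin ?_
  generalize hw : ![A, 2 * D, 8 * M] = w
  have hmem : ∀ i, w i ∈ IntermediateField.adjoin F (Set.range w) :=
    fun i ↦ IntermediateField.subset_adjoin F _ ⟨i, rfl⟩
  have hA : A ∈ IntermediateField.adjoin F (Set.range w) := by simpa [← hw] using hmem 0
  have hD : 2 * D ∈ IntermediateField.adjoin F (Set.range w) := by simpa [← hw] using hmem 1
  have hM : 8 * M ∈ IntermediateField.adjoin F (Set.range w) := by simpa [← hw] using hmem 2
  have hD' := div_mem hD (ofNat_mem _ 2)
  have hN' := sub_mem (mul_mem (ofNat_mem _ 2) hM) (mul_mem (ofNat_mem _ 81) (pow_mem hA 3))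
  rw [mul_div_cancel_left₀ _ h2] at hD'
  rw [show 2 * (8 * M) = 16 * M by ring] at hN'
  intro i
  fin_cases i
  exacts [hD', hN', hA]

lemma algebraicIndependent_secondParameters (h2 : (2 : E) ≠ 0) (h5 : (5 : E) ≠ 0) (hA0 : A ≠ 0) :
    AlgebraicIndependent F ![10 * D / A, A ^ 3 / (64 * M)] := by
  have h10 : (10 : E) ≠ 0 := by
    rw [show (10 : E) = 2 * 5 by norm_num]; exact mul_ne_zero h2 h5
  have h64 : (64 : E) ≠ 0 := by
    rw [show (64 : E) = 2 ^ 6 by norm_num]; exact pow_ne_zero _ h2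
  have h3 : AlgebraicIndependent F ![A, 10 * D / A, A ^ 3 / (64 * M)] := by
    refine h.of_mem_adjoin ?_
    generalize hw : ![A, 10 * D / A, A ^ 3 / (64 * M)] = w
    have hmem : ∀ i, w i ∈ IntermediateField.adjoin F (Set.range w) :=
      fun i ↦ IntermediateField.subset_adjoin F _ ⟨i, rfl⟩
    have hA : A ∈ IntermediateField.adjoin F (Set.range w) := by
      have := hmem 0
      rwa [← hw] at this ⊢
    have hd : 10 * D / A ∈ IntermediateField.adjoin F (Set.range w) := by
      have := hmem 1
      rwa [← hw] at this ⊢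
    have hq : A ^ 3 / (64 * M) ∈ IntermediateField.adjoin F (Set.range w) := by
      have := hmem 2
      rwa [← hw] at this ⊢
    have hD := div_mem (mul_mem hd hA) (ofNat_mem _ 10)
    rw [div_mul_cancel₀ _ hA0, mul_div_cancel_left₀ _ h10] at hD
    have hM := div_mem (div_mem (pow_mem hA 3) hq) (ofNat_mem _ 64)
    rw [div_div_cancel₀ (pow_ne_zero 3 hA0), mul_div_cancel_left₀ _ h64] at hM
    have hN := sub_mem (mul_mem (ofNat_mem _ 16) hM) (mul_mem (ofNat_mem _ 81) (pow_mem hA 3))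
    intro i
    fin_cases i
    exacts [hD, hN, hA]
  have h3' := h3.comp Fin.succ (Fin.succ_injective 2)
  convert h3' using 1
  funext i
  fin_cases i <;> rfl

omit h

variable {f : E ≃ₐ[F] E} (hA : f A = A) (hD : f D = D) (hM : f M = M)
include hA hD hM

lemma map_firstParameters : ∀ i, f (![A, 2 * D, 8 * M] i) = ![A, 2 * D, 8 * M] i := by
  have h2 := map_ofNat f 2
  have h8 := map_ofNat f 8
  simp [Fin.forall_fin_succ, hA, hD, hM, h2, h8]

lemma map_secondParameters :
    ∀ i, f (![10 * D / A, A ^ 3 / (64 * M)] i) = ![10 * D / A, A ^ 3 / (64 * M)] i := by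
  have h10 := map_ofNat f 10
  have h64 := map_ofNat f 64
  simp [Fin.forall_fin_succ, hA, hD, hM, h10, h64]

end Parameters

section RootField

variable {k E : Type*} [Field k] [Field E] [Algebra k E]

/-- The roots of the quintics lie in the field generated by the coordinates of the five points,
which has degree at most `60`; hence the Galois group is no larger than `A₅`. -/
lemma irreducible_separable_gal {s : alternatingGroup (Fin 5) →* (E ≃ₐ[k] E)} {x w : Fin 5 → E}
    (hfin : FiniteDimensional k (IntermediateField.adjoin k (Set.range (coordU x))))
    (hrank : Module.finrank k (IntermediateField.adjoin k (Set.range (coordU x))) ≤ 60)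
    (hw : IsEquivariant s w) (h01 : w 0 ≠ w 1)
    (hmem : ∀ i, w i ∈ IntermediateField.adjoin k (Set.range (coordU x))) {P : k[X]}
    (hP : P.natDegree = 5) (hroot : ∀ i, aeval (w i) P = 0) :
    Irreducible P ∧ P.Separable ∧ Nonempty (P.Gal ≃* alternatingGroup (Fin 5)) := by
  have hP0 : P ≠ 0 := fun h ↦ by simp [h] at hP
  obtain ⟨hirr, hsep, -, -⟩ := minpoly_natDegree_of_isEquivariant hw h01 hP hroot
  refine ⟨hirr, hsep, gal_equiv_alternatingGroup hw h01 hP hroot ?_⟩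
  rw [(splits_of_roots hP0 hP (hw.injective h01) hroot).2.2]
  have hle : IntermediateField.adjoin k (Set.range w) ≤
      IntermediateField.adjoin k (Set.range (coordU x)) := by
    rw [IntermediateField.adjoin_le_iff]
    rintro _ ⟨i, rfl⟩
    exact hmem i
  exact (LinearMap.finrank_le_finrank_of_injective
    (f := (IntermediateField.inclusion hle).toLinearMap)
    (IntermediateField.inclusion hle).injective).trans hrank

variable {s : alternatingGroup (Fin 5) →* (E ≃ₐ[k] E)} {x : Fin 5 → E} (hs : IsEquivariant s x)
  (hA : pentagonSum x ≠ 0) (hD : sqrtDisc x ≠ 0) (hM : hessProd x ≠ 0)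
  (hAD : pentagonSum x ^ 2 + 12 * sqrtDisc x ^ 2 ≠ 0) (h01 : coordU x 0 ≠ coordU x 1)
  (h2 : (2 : k) ≠ 0) (h3 : (3 : k) ≠ 0) (h5 : (5 : k) ≠ 0)
include hs hA hD hM hAD h01 h2 h3 h5

lemma firstPolynomial_irreducible_separable_gal {a d m : k}
    (ha : algebraMap k E a = pentagonSum x) (hd : algebraMap k E d = 2 * sqrtDisc x)
    (hm : algebraMap k E m = 8 * hessProd x) :
    Irreducible (firstPolynomial a (d ^ 2) m) ∧ (firstPolynomial a (d ^ 2) m).Separable ∧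
      Nonempty ((firstPolynomial a (d ^ 2) m).Gal ≃* alternatingGroup (Fin 5)) := by
  have e2 : (2 : E) ≠ 0 := algebraMap_ofNat_ne_zero h2
  have e3 : (3 : E) ≠ 0 := algebraMap_ofNat_ne_zero h3
  have e8 : (8 : E) ≠ 0 := by
    rw [show (8 : E) = 2 ^ 3 by norm_num]; exact pow_ne_zero _ e2
  obtain ⟨hfin, hrank⟩ := finrank_adjoin_coordU_le hs hA hD hM hAD h01 h2 h3 h5
    (d := 5 * d / a) (q := a ^ 3 / (8 * m))
    (by rw [map_div₀, map_mul, map_ofNat, ha, hd]; ring)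
    (by rw [map_div₀, map_mul, map_pow, map_ofNat, ha, hm]; ring)
  have hw : IsEquivariant s fun i ↦ (coordU x i - 1) / 3 := by
    intro g i
    simp only [map_div₀, map_sub, map_one, map_ofNat, hs.coordU g i]
  refine irreducible_separable_gal hfin hrank hw ?_ ?_ ?_ ?_
  · intro h
    rw [div_left_inj' e3, sub_left_inj] at h
    exact h01 h
  · exact fun i ↦ div_mem (sub_mem (IntermediateField.subset_adjoin _ _ ⟨i, rfl⟩) (one_mem _))
      (ofNat_mem _ 3)
  · apply natDegree_firstPolynomial
    rw [show (288 : k) = 2 ^ 5 * 3 ^ 2 by norm_num]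
    refine mul_ne_zero (mul_ne_zero (pow_ne_zero _ h2) (pow_ne_zero _ h3)) (pow_ne_zero _ ?_)
    rintro rfl
    rw [map_zero] at hm
    exact mul_ne_zero e8 hM hm.symm
  · intro i
    rw [← eval_map_algebraMap, map_firstPolynomial, map_pow, ha, hd, hm]
    exact eval_firstPolynomial (injective_of_sqrtDisc_ne_zero hD) hM e2 e3 i

lemma secondPolynomial_irreducible_separable_gal {d q : k}
    (hd : algebraMap k E d = 10 * sqrtDisc x / pentagonSum x)
    (hq : algebraMap k E q = pentagonSum x ^ 3 / (64 * hessProd x)) :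
    Irreducible (secondPolynomial (d ^ 2) q) ∧ (secondPolynomial (d ^ 2) q).Separable ∧
      Nonempty ((secondPolynomial (d ^ 2) q).Gal ≃* alternatingGroup (Fin 5)) := by
  obtain ⟨hfin, hrank⟩ := finrank_adjoin_coordU_le hs hA hD hM hAD h01 h2 h3 h5 hd hq
  refine irreducible_separable_gal hfin hrank hs.coordU h01
    (fun i ↦ IntermediateField.subset_adjoin _ _ ⟨i, rfl⟩) (natDegree_secondPolynomial _ _) ?_
  intro i
  rw [← eval_map_algebraMap, map_secondPolynomial, map_pow, hd, hq]
  exact eval_secondPolynomial (injective_of_sqrtDisc_ne_zero hD) hM (algebraMap_ofNat_ne_zero h2)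
    (algebraMap_ofNat_ne_zero h3) hA i

end RootField

section Generic

variable {F : Type} [Field F] (h2 : (2 : F) ≠ 0) (h3 : (3 : F) ≠ 0)
include h2

lemma pentagonSum_indetPoints_ne_zero : pentagonSum (indetPoints F) ≠ 0 := by
  have := algebraMap_ratFunField_ne_zero (pentagonSum_X_ne_zero F h2)
  rwa [map_pentagonSum] at this

include h3

lemma sqrtDisc_indetPoints_ne_zero : sqrtDisc (indetPoints F) ≠ 0 := by
  have := algebraMap_ratFunField_ne_zero (sqrtDisc_X_ne_zero F h2 h3)
  rwa [map_sqrtDisc] at this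

lemma hessProd_indetPoints_ne_zero : hessProd (indetPoints F) ≠ 0 := by
  have := algebraMap_ratFunField_ne_zero (hessProd_X_ne_zero F h2 h3)
  rwa [map_hessProd] at this

lemma coordU_indetPoints_ne (h5 : (5 : F) ≠ 0) :
    coordU (indetPoints F) 0 ≠ coordU (indetPoints F) 1 := by
  have := algebraMap_ratFunField_ne_zero (coordGap_X_ne_zero F h2 h3)
  rw [map_coordGap] at this
  exact coordU_zero_ne_one (hessProd_indetPoints_ne_zero h2 h3) (algebraMap_ofNat_ne_zero h5) this

omit h3 in
lemma pentagonSum_sq_add_indetPoints_ne_zero :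
    pentagonSum (indetPoints F) ^ 2 + 12 * sqrtDisc (indetPoints F) ^ 2 ≠ 0 := by
  have := algebraMap_ratFunField_ne_zero (pentagonSum_sq_add_X_ne_zero F h2)
  rwa [map_add, map_mul, map_pow, map_pow, map_ofNat, map_pentagonSum, map_sqrtDisc] at this

lemma firstPolynomial_indet_irreducible_separable_gal (h5 : (5 : F) ≠ 0) {P : (RatFunField F 3)[X]}
    (hP : P = firstPolynomial (indet F (0 : Fin 3)) (indet F (1 : Fin 3) ^ 2)
      (indet F (2 : Fin 3))) :
    Irreducible P ∧ P.Separable ∧ Nonempty (P.Gal ≃* alternatingGroup (Fin 5)) := by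
  have e2 : (2 : RatFunField F 5) ≠ 0 := algebraMap_ofNat_ne_zero h2
  have hv := algebraicIndependent_firstParameters (A := pentagonSum (indetPoints F))
    (D := sqrtDisc (indetPoints F)) (M := hessProd (indetPoints F))
    (algebraicIndependent_indetPoints h2 h3) e2
  obtain ⟨_, s, hs, hind⟩ := exists_isEquivariant_of_fixed (m := 3) hv fun g ↦
    map_firstParameters (permuteIndets_pentagonSum g) (permuteIndets_sqrtDisc g)
      (permuteIndets_hessProd g)
  rw [hP]
  exact firstPolynomial_irreducible_separable_gal hs (pentagonSum_indetPoints_ne_zero h2)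
    (sqrtDisc_indetPoints_ne_zero h2 h3) (hessProd_indetPoints_ne_zero h2 h3)
    (pentagonSum_sq_add_indetPoints_ne_zero h2) (coordU_indetPoints_ne h2 h3 h5)
    (algebraMap_ofNat_ne_zero h2) (algebraMap_ofNat_ne_zero h3) (algebraMap_ofNat_ne_zero h5)
    (hind 0) (hind 1) (hind 2)

lemma secondPolynomial_indet_irreducible_separable_gal (h5 : (5 : F) ≠ 0) {P : (RatFunField F 2)[X]}
    (hP : P = secondPolynomial (indet F (0 : Fin 2) ^ 2) (indet F (1 : Fin 2))) :
    Irreducible P ∧ P.Separable ∧ Nonempty (P.Gal ≃* alternatingGroup (Fin 5)) := by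
  have hA := pentagonSum_indetPoints_ne_zero h2
  have e2 : (2 : RatFunField F 5) ≠ 0 := algebraMap_ofNat_ne_zero h2
  have e5 : (5 : RatFunField F 5) ≠ 0 := algebraMap_ofNat_ne_zero h5
  have hv := algebraicIndependent_secondParameters (A := pentagonSum (indetPoints F))
    (D := sqrtDisc (indetPoints F)) (M := hessProd (indetPoints F))
    (algebraicIndependent_indetPoints h2 h3) e2 e5 hA
  obtain ⟨_, s, hs, hind⟩ := exists_isEquivariant_of_fixed (m := 2) hv fun g ↦
    map_secondParameters (permuteIndets_pentagonSum g) (permuteIndets_sqrtDisc g)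
      (permuteIndets_hessProd g)
  rw [hP]
  exact secondPolynomial_irreducible_separable_gal hs hA
    (sqrtDisc_indetPoints_ne_zero h2 h3) (hessProd_indetPoints_ne_zero h2 h3)
    (pentagonSum_sq_add_indetPoints_ne_zero h2) (coordU_indetPoints_ne h2 h3 h5)
    (algebraMap_ofNat_ne_zero h2) (algebraMap_ofNat_ne_zero h3) (algebraMap_ofNat_ne_zero h5)
    (hind 0) (hind 1)

end Generic


theorem theorem2 :
    IsGenericOutside.{u, v} {2, 3, 5} (alternatingGroup (Fin 5))
      (firstPolynomial (indet ℚ (0 : Fin 3)) (indet ℚ (1 : Fin 3) ^ 2) (indet ℚ (2 : Fin 3))) ∧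
    IsGenericOutside.{u, v} {2, 3, 5} (alternatingGroup (Fin 5))
      (secondPolynomial (indet ℚ (0 : Fin 2) ^ 2) (indet ℚ (1 : Fin 2))) := by
  have h2 : (2 : ℚ) ≠ 0 := two_ne_zero
  have h3 : (3 : ℚ) ≠ 0 := three_ne_zero
  have h5 : (5 : ℚ) ≠ 0 := by norm_num
  have : Fact (Nat.Prime 5) := ⟨Nat.prime_five⟩
  have hp : ∀ (p : ℕ) [Fact p.Prime], p ∉ ({2, 3, 5} : Finset ℕ) →
      (2 : ZMod p) ≠ 0 ∧ (3 : ZMod p) ≠ 0 ∧ (5 : ZMod p) ≠ 0 := by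
    intro p _ hp
    simp only [Finset.mem_insert, Finset.mem_singleton, not_or] at hp
    exact ⟨by exact_mod_cast ZMod.prime_ne_zero p 2 hp.1,
      by exact_mod_cast ZMod.prime_ne_zero p 3 hp.2.1,
      by exact_mod_cast ZMod.prime_ne_zero p 5 hp.2.2⟩
  constructor
  · refine ⟨(firstPolynomial_indet_irreducible_separable_gal h2 h3 h5 rfl).2.2,
      firstPolynomial_parametrizesExtensions h2 h3 h5, fun p _ hpS ↦ ?_⟩
    obtain ⟨p2, p3, p5⟩ := hp p hpS
    obtain ⟨hirr, hsep, hgal⟩ := firstPolynomial_indet_irreducible_separable_gal p2 p3 p5 rfl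
    exact ⟨_, firstPolynomial_reducesTo p, hsep, hirr, hgal,
      firstPolynomial_parametrizesExtensions p2 p3 p5⟩
  · refine ⟨(secondPolynomial_indet_irreducible_separable_gal h2 h3 h5 rfl).2.2,
      secondPolynomial_parametrizesExtensions h2 h3 h5, fun p _ hpS ↦ ?_⟩
    obtain ⟨p2, p3, p5⟩ := hp p hpS
    obtain ⟨hirr, hsep, hgal⟩ := secondPolynomial_indet_irreducible_separable_gal p2 p3 p5 rfl
    exact ⟨_, secondPolynomial_reducesTo p, hsep, hirr, hgal,
      secondPolynomial_parametrizesExtensions p2 p3 p5⟩
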